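/- Let $\ell$ be a prime number, let $L/K$ be a finite Galois extension of number fields with Galois group $G$. For a place $\mathfrak P$ of $L$ (finite or infinite) with completion $L_{\mathfrak P}$ let $\mathcal R_{L_{\mathfrak P}}=\varprojlim_k L_{\mathfrak P}^\times/(L_{\mathfrak P}^{\times})^{\ell^k}$ be the $\ell$-adification of its multiplicative group, a $\mathbb Z_\ell$-module, and, for $\mathfrak P$ finite, let $\mathcal U_{L_{\mathfrak P}}\subset\mathcal R_{L_{\mathfrak P}}$ be the image of the $\ell$-adification of the group of units of the valuation ring of $L_{\mathfrak P}$ (for $\mathfrak P$ infinite put $\mathcal U_{L_{\mathfrak P}}=1$). Let $\mathcal J_L$ be the $\mathbb Z_\ell[G]$-module of $\ell$-adic ideles of $L$, i.e. the restricted product of the $\mathcal R_{L_{\mathfrak P}}$ over all places $\mathfrak P$ of $L$ with respect to the $\mathcal U_{L_{\mathfrak P}}$. For a finite set $S$ of places of $K$ let $\mathcal J_L^S\subset\mathcal J_L$ be the submodule of those ideles whose component at $\mathfrak P$ lies in $\mathcal U_{L_{\mathfrak P}}$ for every place $\mathfrak P$ of $L$ that does not lie above a place in $S$. For a subgroup $H$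 of $G$ and a $\mathbb Z_\ell[H]$-module $M$ let $H^i_\ell(H,M)$ denote Tate cohomology over $\mathbb Z_\ell$; in particular $H^0_\ell(H,M)$ is the module of invariants $M^H$ modulo norms $N_H M$. Choose for every place $\mathfrak p$ of $K$ a place $\mathfrak P$ of $L$ above $\mathfrak p$, and let $G_{\mathfrak P}\subset G$ be its decomposition group. Suppose that $S$ contains all infinite places of $K$ and all primes of $K$ that ramify in $L$. Then for $i=0,1$ there are isomorphisms of $\mathbb Z_\ell$-modules $$H^i_\ell(G,\mathcal J_L^S)\;\cong\;\bigoplus_{\mathfrak p\in S}H^i_\ell(G_{\mathfrak P},\mathcal R_{L_{\mathfrak P}}),\qquad H^i_\ell(G,\mathcal J_L)\;\cong\;\bigoplus_{\mathfrak p}H^i_\ell(G_{\mathfrak P},\mathcal R_{L_{\mathfrak P}}),$$ the second sum being over all places $\mathfrak p$ of $K$. In both, the component at $\mathfrak p$ is the restriction from $G$ to $G_{\mathfrak P}$ followed by the map induced by the projection of an idele to its component at $\mathfrak P$. -/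

import Mathlib

open NumberField IsDedekindDomain

namespace EllAdic

/-! ### The `ℓ`-adification of an abelian group -/

section LAdic

variable (ℓ : ℕ) [Fact ℓ.Prime]

/-- The canonical ring homomorphism from `ℤ_ℓ` to `lim ℤ / ℓ^k ℤ`. -/
noncomputable def padicToLim : ℤ_[ℓ] →+* AdicCompletion (Ideal.span {(ℓ : ℤ)}) ℤ :=
  AdicCompletion.liftRingHom _
    (fun n => ((Ideal.quotEquivOfEq (by
        rw [Ideal.span_singleton_pow, Nat.cast_pow] :
          Ideal.span {((ℓ ^ n : ℕ) : ℤ)} = Ideal.span {(ℓ : ℤ)} ^ n)).toRingHom.comp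
      (Int.quotientSpanNatEquivZMod (ℓ ^ n)).symm.toRingHom).comp (PadicInt.toZModPow n))
    (by
      intro m n hle
      have : NeZero (ℓ ^ n) := ⟨pow_ne_zero _ (Fact.out : ℓ.Prime).ne_zero⟩
      refine RingHom.ext fun x => ?_
      have h1 : PadicInt.toZModPow n x = ((PadicInt.toZModPow n x).val : ZMod (ℓ ^ n)) := by simp
      have h2 : PadicInt.toZModPow m x = ((PadicInt.toZModPow n x).val : ZMod (ℓ ^ m)) := by
        rw [← PadicInt.cast_toZModPow m n hle x, ZMod.natCast_val]
      simp only [RingHom.comp_apply]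
      rw [h2, h1, map_natCast, map_natCast, map_natCast, map_natCast, map_natCast, ← h1])

/-- The `ℓ`-adification `lim_k A / A^{ℓ^k}` of an abelian group `A` (written multiplicatively);
the limit itself is written additively. -/
def LAdic (A : Type*) [CommGroup A] : Type _ :=
  AdicCompletion (Ideal.span {(ℓ : ℤ)}) (Additive A)

noncomputable instance (A : Type*) [CommGroup A] : AddCommGroup (LAdic ℓ A) :=
  inferInstanceAs (AddCommGroup (AdicCompletion (Ideal.span {(ℓ : ℤ)}) (Additive A)))

noncomputable instance (A : Type*) [CommGroup A] :
    Module (AdicCompletion (Ideal.span {(ℓ : ℤ)}) ℤ) (LAdic ℓ A) :=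
  inferInstanceAs (Module (AdicCompletion (Ideal.span {(ℓ : ℤ)}) ℤ)
    (AdicCompletion (Ideal.span {(ℓ : ℤ)}) (Additive A)))

noncomputable instance (A : Type*) [CommGroup A] : Module ℤ_[ℓ] (LAdic ℓ A) :=
  Module.compHom (LAdic ℓ A) (padicToLim ℓ)

/-- Functoriality of the `ℓ`-adification. -/
noncomputable def LAdic.map {A B : Type*} [CommGroup A] [CommGroup B] (f : A →* B) :
    LAdic ℓ A →ₗ[ℤ_[ℓ]] LAdic ℓ B where
  toFun := AdicCompletion.map (Ideal.span {(ℓ : ℤ)}) (MonoidHom.toAdditive f).toIntLinearMap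
  map_add' := map_add (AdicCompletion.map (Ideal.span {(ℓ : ℤ)})
    (MonoidHom.toAdditive f).toIntLinearMap)
  map_smul' c x := map_smul (AdicCompletion.map (Ideal.span {(ℓ : ℤ)})
    (MonoidHom.toAdditive f).toIntLinearMap) (padicToLim ℓ c) x

theorem LAdic.map_id (A : Type*) [CommGroup A] : LAdic.map ℓ (MonoidHom.id A) = LinearMap.id :=
  LinearMap.ext fun x => LinearMap.congr_fun
    (AdicCompletion.map_id (Ideal.span {(ℓ : ℤ)}) (M := Additive A)) x

theorem LAdic.map_map {A B C : Type*} [CommGroup A] [CommGroup B] [CommGroup C]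
    (f : A →* B) (g : B →* C) (x : LAdic ℓ A) :
    LAdic.map ℓ g (LAdic.map ℓ f x) = LAdic.map ℓ (g.comp f) x :=
  AdicCompletion.map_comp_apply (Ideal.span {(ℓ : ℤ)})
    (MonoidHom.toAdditive f).toIntLinearMap (MonoidHom.toAdditive g).toIntLinearMap x

end LAdic

/-! ### Places and completions -/

/-- A place of a number field. -/
inductive Place (L : Type*) [Field L] [NumberField L]
  | finite (P : HeightOneSpectrum (𝓞 L)) : Place L
  | infinite (w : InfinitePlace L) : Place L

/-- The completion of `L` at a place. -/
def Place.Completion {L : Type*} [Field L] [NumberField L] : Place L → Type _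
  | .finite P => P.adicCompletion L
  | .infinite w => w.Completion

noncomputable instance {L : Type*} [Field L] [NumberField L] (v : Place L) : Field v.Completion :=
  match v with
  | .finite P => inferInstanceAs (Field (P.adicCompletion L))
  | .infinite w => inferInstanceAs (Field w.Completion)

section Galois

variable {L : Type*} [Field L] [NumberField L]

theorem continuous_withVal_map (P Q : HeightOneSpectrum (𝓞 L)) (σ : L ≃+* L)
    (h : ∀ x, Q.valuation L (σ x) = P.valuation L x) :
    Continuous (WithVal.map (P.valuation L) (Q.valuation L) (σ : L →+* L)) := by
  refine (uniformContinuous_of_continuousAt_zero _ ?_).continuous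
  simp_rw [ContinuousAt, map_zero, (Valued.hasBasis_nhds_zero _ _).tendsto_iff
    (Valued.hasBasis_nhds_zero _ _), true_and, forall_const]
  intro γ
  obtain ⟨r, s, hr, hs, hγ⟩ := Valuation.restrict_exists_div_eq
    (Valued.v : Valuation (WithVal (Q.valuation L)) _) γ
  obtain ⟨r₀, hr₀⟩ := σ.surjective r.ofVal
  obtain ⟨s₀, hs₀⟩ := σ.surjective s.ofVal
  have hv : ∀ (t : WithVal (Q.valuation L)) (t₀ : L), σ t₀ = t.ofVal →
      P.valuation L t₀ = Valued.v t := fun t t₀ ht => by rw [← h, ht]; rfl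
  have hr1 : 0 < (Valued.v (WithVal.toVal (P.valuation L) r₀)) := by
    rw [WithVal.valued_toVal, hv r r₀ hr₀]; exact hr
  have hs1 : 0 < (Valued.v (WithVal.toVal (P.valuation L) s₀)) := by
    rw [WithVal.valued_toVal, hv s s₀ hs₀]; exact hs
  refine ⟨.mk0 (Valued.v.restrict (WithVal.toVal (P.valuation L) r₀) /
    Valued.v.restrict (WithVal.toVal (P.valuation L) s₀)) (div_ne_zero
      (((Valuation.restrict_pos_iff _ _).mpr hr1).ne')
      (((Valuation.restrict_pos_iff _ _).mpr hs1).ne')), fun x hx => ?_⟩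
  simp only [Units.val_mk0, Set.mem_ofPred_eq] at hx ⊢
  rw [lt_div_iff₀ ((Valuation.restrict_pos_iff _ _).mpr hs1), ← map_mul,
    Valuation.restrict_lt_iff, map_mul, WithVal.valued_toVal (P.valuation L) r₀,
    WithVal.valued_toVal (P.valuation L) s₀, hv r r₀ hr₀, hv s s₀ hs₀,
    ← WithVal.apply_ofVal (P.valuation L) x, ← h] at hx
  rw [← hγ, lt_div_iff₀ ((Valuation.restrict_pos_iff _ _).mpr hs), ← map_mul,
    Valuation.restrict_lt_iff, map_mul]
  exact hx

/-- The isomorphism of completions `L_P → L_Q` extending an automorphism `σ` of `L` that carries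
the `P`-adic valuation to the `Q`-adic one. -/
noncomputable def finiteMap (P Q : HeightOneSpectrum (𝓞 L)) (σ : L ≃+* L)
    (h : ∀ x, Q.valuation L (σ x) = P.valuation L x) : P.adicCompletion L →+* Q.adicCompletion L :=
  ((HeightOneSpectrum.adicCompletion.equiv L Q).symm.toRingHom.comp
    (UniformSpace.Completion.mapRingHom _ (continuous_withVal_map P Q σ h))).comp
    (HeightOneSpectrum.adicCompletion.equiv L P).toRingHom

theorem continuous_finiteMap (P Q : HeightOneSpectrum (𝓞 L)) (σ : L ≃+* L)
    (h : ∀ x, Q.valuation L (σ x) = P.valuation L x) : Continuous (finiteMap P Q σ h) :=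
  (HeightOneSpectrum.adicCompletion.continuous_ofCompletion L Q).comp <|
    UniformSpace.Completion.continuous_map.comp
      (HeightOneSpectrum.adicCompletion.continuous_toCompletion L P)

theorem finiteMap_algebraMap (P Q : HeightOneSpectrum (𝓞 L)) (σ : L ≃+* L)
    (h : ∀ x, Q.valuation L (σ x) = P.valuation L x) (x : L) :
    finiteMap P Q σ h (algebraMap L _ x) = algebraMap L _ (σ x) := by
  apply HeightOneSpectrum.adicCompletion.ext
  exact UniformSpace.Completion.mapRingHom_coe (continuous_withVal_map P Q σ h) _

theorem finiteMap_finiteMap (P Q R : HeightOneSpectrum (𝓞 L)) (σ τ ρ : L ≃+* L)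
    (h : ∀ x, Q.valuation L (σ x) = P.valuation L x)
    (h' : ∀ x, R.valuation L (τ x) = Q.valuation L x)
    (h'' : ∀ x, R.valuation L (ρ x) = P.valuation L x) (hρ : ∀ x, ρ x = τ (σ x))
    (x : P.adicCompletion L) :
    finiteMap Q R τ h' (finiteMap P Q σ h x) = finiteMap P R ρ h'' x := by
  refine congrFun (DenseRange.equalizer (HeightOneSpectrum.denseRange_algebraMap L P)
    ((continuous_finiteMap Q R τ h').comp (continuous_finiteMap P Q σ h))
    (continuous_finiteMap P R ρ h'') (funext fun y => ?_)) x
  simp [finiteMap_algebraMap, hρ]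

theorem finiteMap_self (P : HeightOneSpectrum (𝓞 L)) (σ : L ≃+* L)
    (h : ∀ x, P.valuation L (σ x) = P.valuation L x) (hσ : ∀ x, σ x = x)
    (x : P.adicCompletion L) : finiteMap P P σ h x = x := by
  refine congrFun (DenseRange.equalizer (HeightOneSpectrum.denseRange_algebraMap L P)
    (continuous_finiteMap P P σ h) continuous_id (funext fun y => ?_)) x
  simp [finiteMap_algebraMap, hσ]

theorem finiteMap_mem_integers (P Q : HeightOneSpectrum (𝓞 L)) (σ : L ≃+* L)
    (h : ∀ x, Q.valuation L (σ x) = P.valuation L x) (x : P.adicCompletion L)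
    (hx : x ∈ P.adicCompletionIntegers L) :
    finiteMap P Q σ h x ∈ Q.adicCompletionIntegers L := by
  refine DenseRange.induction_on (HeightOneSpectrum.denseRange_algebraMap L P)
    (p := fun y => y ∈ P.adicCompletionIntegers L →
      finiteMap P Q σ h y ∈ Q.adicCompletionIntegers L) x
    (isClosed_imp (Valued.isOpen_valuationSubring _) ((Valued.isClosed_valuationSubring _).preimage
      (continuous_finiteMap P Q σ h))) (fun y hy => ?_) hx
  rw [HeightOneSpectrum.mem_adicCompletionIntegers] at hy ⊢
  rw [finiteMap_algebraMap]
  erw [HeightOneSpectrum.valuedAdicCompletion_eq_valuation'] at hy ⊢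
  exact (h y).trans_le hy

/-- The map on rings of integers induced by `finiteMap`. -/
noncomputable def finiteMapIntegers (P Q : HeightOneSpectrum (𝓞 L)) (σ : L ≃+* L)
    (h : ∀ x, Q.valuation L (σ x) = P.valuation L x) :
    P.adicCompletionIntegers L →+* Q.adicCompletionIntegers L :=
  (finiteMap P Q σ h).restrict _ _ (finiteMap_mem_integers P Q σ h)

end Galois

section GaloisInfinite

variable {L : Type*} [Field L]

theorem isometry_withAbs_map (w w' : InfinitePlace L) (σ : L ≃+* L) (h : ∀ x, w' (σ x) = w x) :
    Isometry (((WithAbs.equiv w'.1).symm.toRingHom.comp (σ : L →+* L)).comp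
      (WithAbs.equiv w.1).toRingHom) :=
  AddMonoidHomClass.isometry_of_norm _ fun x => by
    rw [WithAbs.norm_eq_apply_ofAbs, WithAbs.norm_eq_apply_ofAbs]
    exact h x.ofAbs

/-- The isomorphism of completions `L_w → L_{w'}` at infinite places extending an automorphism `σ`
of `L` that carries `|·|_w` to `|·|_{w'}`. -/
noncomputable def infiniteMap (w w' : InfinitePlace L) (σ : L ≃+* L)
    (h : ∀ x, w' (σ x) = w x) : w.Completion →+* w'.Completion :=
  ((InfinitePlace.Completion.equiv w').symm.toRingHom.comp
    (isometry_withAbs_map w w' σ h).mapRingHom).comp (InfinitePlace.Completion.equiv w).toRingHom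

theorem continuous_infiniteMap (w w' : InfinitePlace L) (σ : L ≃+* L) (h : ∀ x, w' (σ x) = w x) :
    Continuous (infiniteMap w w' σ h) :=
  (InfinitePlace.Completion.continuous_ofCompletion w').comp <|
    UniformSpace.Completion.continuous_map.comp
      (InfinitePlace.Completion.continuous_toCompletion w)

theorem infiniteMap_coe (w w' : InfinitePlace L) (σ : L ≃+* L) (h : ∀ x, w' (σ x) = w x)
    (x : WithAbs w.1) :
    infiniteMap w w' σ h x = (WithAbs.toAbs w'.1 (σ x.ofAbs) : WithAbs w'.1) :=
  InfinitePlace.Completion.ext ((isometry_withAbs_map w w' σ h).mapRingHom_coe x)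

theorem infiniteMap_infiniteMap (u v w : InfinitePlace L) (σ τ ρ : L ≃+* L)
    (h : ∀ x, v (σ x) = u x) (h' : ∀ x, w (τ x) = v x) (h'' : ∀ x, w (ρ x) = u x)
    (hρ : ∀ x, ρ x = τ (σ x)) (x : u.Completion) :
    infiniteMap v w τ h' (infiniteMap u v σ h x) = infiniteMap u w ρ h'' x := by
  refine congrFun (DenseRange.equalizer (InfinitePlace.Completion.denseRange_coe u)
    ((continuous_infiniteMap v w τ h').comp (continuous_infiniteMap u v σ h))
    (continuous_infiniteMap u w ρ h'') (funext fun y => ?_)) x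
  simp [infiniteMap_coe, hρ]

theorem infiniteMap_self (w : InfinitePlace L) (σ : L ≃+* L) (h : ∀ x, w (σ x) = w x)
    (hσ : ∀ x, σ x = x) (x : w.Completion) : infiniteMap w w σ h x = x := by
  refine congrFun (DenseRange.equalizer (InfinitePlace.Completion.denseRange_coe w)
    (continuous_infiniteMap w w σ h) continuous_id (funext fun y => ?_)) x
  simp [infiniteMap_coe, hσ]

end GaloisInfinite

section Action

variable (K : Type*) {L : Type*} [Field K] [Field L] [NumberField L] [Algebra K L]

/-- The Galois group permutes the places: `σ • P = σ(P)` for a prime `P` and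
`|x|_{σ • w} = |σ⁻¹ x|_w` for an infinite place `w`. -/
noncomputable instance : MulAction (L ≃ₐ[K] L) (Place L) where
  smul σ v := match v with
    | .finite P => .finite (HeightOneSpectrum.equivOfRingEquiv
        (RingOfIntegers.mapRingEquiv (σ : L ≃+* L)) P)
    | .infinite w => .infinite (σ • w)
  one_smul v := by
    cases v with
    | finite P => exact congrArg Place.finite (HeightOneSpectrum.ext (Ideal.ext fun x => Iff.rfl))
    | infinite w => exact congrArg Place.infinite (one_smul _ w)
  mul_smul σ τ v := by
    cases v with
    | finite P => exact congrArg Place.finite (HeightOneSpectrum.ext (Ideal.ext fun x => Iff.rfl))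
    | infinite w => exact congrArg Place.infinite (mul_smul σ τ w)

theorem smul_finite (σ : L ≃ₐ[K] L) (P : HeightOneSpectrum (𝓞 L)) :
    σ • Place.finite P = .finite (HeightOneSpectrum.equivOfRingEquiv
      (RingOfIntegers.mapRingEquiv (σ : L ≃+* L)) P) := rfl

theorem smul_infinite (σ : L ≃ₐ[K] L) (w : InfinitePlace L) :
    σ • Place.infinite w = .infinite (σ • w) := rfl

variable {K}

theorem valuation_of_smul_eq (σ : L ≃ₐ[K] L) (P Q : HeightOneSpectrum (𝓞 L))
    (h : σ • Place.finite P = .finite Q) (x : L) :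
    Q.valuation L ((σ : L ≃+* L) x) = P.valuation L x := by
  rw [smul_finite] at h
  obtain rfl := Place.finite.inj h
  have hint : ∀ r : 𝓞 L, (HeightOneSpectrum.equivOfRingEquiv
      (RingOfIntegers.mapRingEquiv (σ : L ≃+* L)) P).intValuation
      (RingOfIntegers.mapRingEquiv (σ : L ≃+* L) r) = P.intValuation r := by
    intro r
    set e := RingOfIntegers.mapRingEquiv (σ : L ≃+* L)
    have hQ : (HeightOneSpectrum.equivOfRingEquiv e P).asIdeal = P.asIdeal.map e :=
      (Ideal.map_comap_of_equiv e).symm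
    have hle : ∀ n : ℕ, (HeightOneSpectrum.equivOfRingEquiv e P).intValuation (e r) ≤
        WithZero.exp (-(n : ℤ)) ↔ P.intValuation r ≤ WithZero.exp (-(n : ℤ)) := by
      intro n
      rw [HeightOneSpectrum.intValuation_le_pow_iff_mem,
        HeightOneSpectrum.intValuation_le_pow_iff_mem, hQ, ← Ideal.map_pow,
        Ideal.mem_map_of_equiv]
      simp
    by_cases hr : r = 0
    · simp [hr]
    · have hr' : e r ≠ 0 := by simpa using hr
      refine le_antisymm ?_ ?_
      · rw [HeightOneSpectrum.intValuation_eq_exp_neg_multiplicity _ hr, hle,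
          ← HeightOneSpectrum.intValuation_eq_exp_neg_multiplicity _ hr]
      · rw [HeightOneSpectrum.intValuation_eq_exp_neg_multiplicity _ hr', ← hle,
          ← HeightOneSpectrum.intValuation_eq_exp_neg_multiplicity _ hr']
  obtain ⟨a, b, hb, rfl⟩ := IsFractionRing.div_surjective (A := 𝓞 L) x
  have key : ∀ a : 𝓞 L, (σ : L ≃+* L) (algebraMap (𝓞 L) L a) =
    algebraMap (𝓞 L) L (RingOfIntegers.mapRingEquiv (σ : L ≃+* L) a) := fun _ => rfl
  rw [map_div₀, map_div₀, map_div₀, key, key, HeightOneSpectrum.valuation_of_algebraMap,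
    HeightOneSpectrum.valuation_of_algebraMap, HeightOneSpectrum.valuation_of_algebraMap,
    HeightOneSpectrum.valuation_of_algebraMap, hint, hint]

theorem apply_of_smul_eq (σ : L ≃ₐ[K] L) (w w' : InfinitePlace L)
    (h : σ • Place.infinite w = .infinite w') (x : L) : w' ((σ : L ≃+* L) x) = w x := by
  rw [smul_infinite] at h
  obtain rfl := Place.infinite.inj h
  simp

/-- The isomorphism `L_u → L_v` of completions extending an automorphism `σ` of `L` with
`σ • u = v`. -/
noncomputable def galMap (σ : L ≃ₐ[K] L) : (u v : Place L) → σ • u = v →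
    (u.Completion →+* v.Completion)
  | .finite P, .finite Q, h => finiteMap P Q σ (valuation_of_smul_eq σ P Q h)
  | .infinite w, .infinite w', h => infiniteMap w w' σ (apply_of_smul_eq σ w w' h)
  | .finite _, .infinite _, h => (nomatch h)
  | .infinite _, .finite _, h => (nomatch h)

theorem galMap_galMap (σ τ ρ : L ≃ₐ[K] L) (hρ : ρ = τ * σ) (u v w : Place L) (h : σ • u = v)
    (h' : τ • v = w) (h'' : ρ • u = w) (x : u.Completion) :
    galMap τ v w h' (galMap σ u v h x) = galMap ρ u w h'' x := by
  subst hρ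
  match u, v, w, h, h', h'' with
  | .finite P, .finite Q, .finite R, h, h', h'' =>
    exact finiteMap_finiteMap P Q R (σ : L ≃+* L) (τ : L ≃+* L) ((τ * σ : L ≃ₐ[K] L) : L ≃+* L)
      (valuation_of_smul_eq σ P Q h) (valuation_of_smul_eq τ Q R h')
      (valuation_of_smul_eq (τ * σ) P R h'') (fun _ => rfl) x
  | .infinite P, .infinite Q, .infinite R, h, h', h'' =>
    exact infiniteMap_infiniteMap P Q R (σ : L ≃+* L) (τ : L ≃+* L)
      ((τ * σ : L ≃ₐ[K] L) : L ≃+* L) (apply_of_smul_eq σ P Q h) (apply_of_smul_eq τ Q R h')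
      (apply_of_smul_eq (τ * σ) P R h'') (fun _ => rfl) x

theorem galMap_one (u : Place L) (h : (1 : L ≃ₐ[K] L) • u = u) (x : u.Completion) :
    galMap 1 u u h x = x := by
  match u, h with
  | .finite P, h => 
    exact finiteMap_self P ((1 : L ≃ₐ[K] L) : L ≃+* L) (valuation_of_smul_eq 1 P P h)
      (fun _ => rfl) x
  | .infinite P, h => 
    exact infiniteMap_self P ((1 : L ≃ₐ[K] L) : L ≃+* L) (apply_of_smul_eq 1 P P h)
      (fun _ => rfl) x

/-! ### The local modules `R_{L_v}` and `U_{L_v}` -/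

variable (ℓ : ℕ) [Fact ℓ.Prime]

/-- `R_{L_v} = lim_k L_v^× / (L_v^×)^{ℓ^k}`, the `ℓ`-adification of the multiplicative group of
the completion `L_v`. -/
abbrev localR (v : Place L) : Type _ := LAdic ℓ (v.Completion)ˣ

/-- The map `R_{L_u} → R_{L_v}` induced by an automorphism `σ` with `σ • u = v`. -/
noncomputable def galR (σ : L ≃ₐ[K] L) (u v : Place L) (h : σ • u = v) :
    localR ℓ u →ₗ[ℤ_[ℓ]] localR ℓ v :=
  LAdic.map ℓ (Units.map (galMap σ u v h : u.Completion →* v.Completion))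

theorem galR_galR (σ τ ρ : L ≃ₐ[K] L) (hρ : ρ = τ * σ) (u v w : Place L) (h : σ • u = v)
    (h' : τ • v = w) (h'' : ρ • u = w) (x : localR ℓ u) :
    galR ℓ τ v w h' (galR ℓ σ u v h x) = galR ℓ ρ u w h'' x := by
  unfold galR
  rw [LAdic.map_map]
  congr 2
  ext y
  exact galMap_galMap σ τ ρ hρ u v w h h' h'' y

theorem galR_one (u : Place L) (h : (1 : L ≃ₐ[K] L) • u = u) (x : localR ℓ u) :
    galR ℓ 1 u u h x = x := by
  have : Units.map (galMap (1 : L ≃ₐ[K] L) u u h : u.Completion →* u.Completion) =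
      MonoidHom.id _ := by
    ext y
    exact galMap_one u h y
  unfold galR
  rw [this, LAdic.map_id]
  rfl

/-- The inclusion of the local units `U_P` in `L_P^×`. -/
noncomputable def unitsInclusion (P : HeightOneSpectrum (𝓞 L)) :
    (P.adicCompletionIntegers L)ˣ →* ((Place.finite P).Completion)ˣ :=
  Units.map ((P.adicCompletionIntegers L).subtype : _ →* P.adicCompletion L)

/-- `U_{L_P} = lim_k U_P / U_P^{ℓ^k}`, the `ℓ`-adification of the group of units of `L_P`, viewed
inside `R_{L_P}`; it is taken to be trivial at the infinite places. -/
noncomputable def localU : (v : Place L) → Submodule ℤ_[ℓ] (localR ℓ v)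
  | .finite P => LinearMap.range (LAdic.map ℓ (unitsInclusion P))
  | .infinite _ => ⊥

theorem galR_mem_localU (σ : L ≃ₐ[K] L) (u v : Place L) (h : σ • u = v) (x : localR ℓ u)
    (hx : x ∈ localU ℓ u) : galR ℓ σ u v h x ∈ localU ℓ v := by
  match u, v, h, x, hx with
  | .finite P, .finite Q, h, x, hx =>
    obtain ⟨y, rfl⟩ := hx
    refine ⟨LAdic.map ℓ (Units.map (finiteMapIntegers P Q σ (valuation_of_smul_eq σ P Q h) :
      P.adicCompletionIntegers L →* Q.adicCompletionIntegers L)) y, ?_⟩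
    unfold galR
    rw [LAdic.map_map, LAdic.map_map]
    rfl
  | .infinite w, .infinite w', h, x, hx =>
    have hx0 : x = 0 := hx
    rw [hx0, map_zero]
    exact Submodule.zero_mem _

/-- The action of the decomposition group of `v` on `R_{L_v}`. -/
noncomputable def decompositionRep (v : Place L) :
    Representation ℤ_[ℓ] (MulAction.stabilizer (L ≃ₐ[K] L) v) (localR ℓ v) where
  toFun σ := galR ℓ σ.1 v v σ.2
  map_one' := LinearMap.ext fun x => galR_one ℓ v _ x
  map_mul' σ τ := LinearMap.ext fun x => (galR_galR ℓ τ.1 σ.1 _ rfl v v v τ.2 σ.2 _ x).symm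

/-! ### Ideles -/

/-- The action of the Galois group on `∏_v R_{L_v}`: `(σ x)_v = σ (x_{σ⁻¹ v})`. -/
noncomputable def productRep : Representation ℤ_[ℓ] (L ≃ₐ[K] L) (∀ v : Place L, localR ℓ v) where
  toFun σ := LinearMap.pi fun v =>
    galR ℓ σ (σ⁻¹ • v) v (smul_inv_smul σ v) ∘ₗ LinearMap.proj (σ⁻¹ • v)
  map_one' := by
    refine LinearMap.ext fun x => funext fun v => ?_
    have : ∀ (u : Place L) (hu : u = v) (h : (1 : L ≃ₐ[K] L) • u = v),
        galR ℓ 1 u v h (x u) = x v := by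
      rintro u rfl h
      exact galR_one ℓ u h _
    exact this _ (by simp) _
  map_mul' σ τ := by
    refine LinearMap.ext fun x => funext fun v => ?_
    have : ∀ (u u' : Place L) (hu : u = u') (h : (σ * τ) • u = v) (h' : τ • u' = σ⁻¹ • v),
        galR ℓ (σ * τ) u v h (x u) =
          galR ℓ σ (σ⁻¹ • v) v (smul_inv_smul σ v) (galR ℓ τ u' (σ⁻¹ • v) h' (x u')) := by
      rintro u _ rfl h h'
      exact (galR_galR ℓ τ σ _ rfl u _ v h' _ h (x u)).symm
    exact this _ _ (by rw [mul_inv_rev, mul_smul]) _ (smul_inv_smul τ _)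

theorem productRep_apply (σ : L ≃ₐ[K] L) (x : ∀ v : Place L, localR ℓ v) (v : Place L) :
    productRep ℓ σ x v = galR ℓ σ (σ⁻¹ • v) v (smul_inv_smul σ v) (x (σ⁻¹ • v)) := rfl

/-- A place of `L` lies over a place of `K`. -/
def Place.LiesOver [NumberField K] : Place L → Place K → Prop
  | .finite P, .finite p => P.asIdeal.LiesOver p.asIdeal
  | .infinite w, .infinite v => w.LiesOver v
  | _, _ => False

theorem Place.LiesOver.smul [NumberField K] (σ : L ≃ₐ[K] L) {v : Place L} {p : Place K}
    (h : v.LiesOver p) : (σ • v).LiesOver p := by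
  match v, p, h with
  | .finite P, .finite p, h =>
    refine ⟨?_⟩
    have h' : p.asIdeal = P.asIdeal.comap (algebraMap (𝓞 K) (𝓞 L)) :=
      Ideal.LiesOver.over (self := h)
    rw [h']
    refine Ideal.ext fun x => ?_
    have hx : (RingOfIntegers.mapRingEquiv (σ : L ≃+* L)).symm (algebraMap (𝓞 K) (𝓞 L) x) =
        algebraMap (𝓞 K) (𝓞 L) x := by
      rw [RingEquiv.symm_apply_eq]
      exact RingOfIntegers.ext (σ.commutes (x : K)).symm
    change _ ↔ (RingOfIntegers.mapRingEquiv (σ : L ≃+* L)).symm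
      (algebraMap (𝓞 K) (𝓞 L) x) ∈ P.asIdeal
    rw [hx]
    rfl
  | .infinite w, .infinite v, h =>
    refine ⟨?_⟩
    rw [← AbsoluteValue.LiesOver.comp_eq (self := h)]
    ext x
    exact congrArg w (σ.symm.commutes x)

end Action

section Ideles

variable (ℓ : ℕ) [Fact ℓ.Prime] (K L : Type*) [Field K] [Field L] [NumberField L] [Algebra K L]

/-- The `ℓ`-adic idele group `J_L`: the restricted product of the `R_{L_v}` with respect to the
`U_{L_v}`, as a Galois module. -/
noncomputable def ideles : Subrepresentation
    (productRep ℓ : Representation ℤ_[ℓ] (L ≃ₐ[K] L) (∀ v : Place L, localR ℓ v)) where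
  toSubmodule :=
    { carrier := {x | {v | x v ∉ localU ℓ v}.Finite}
      zero_mem' := by simp
      add_mem' := fun {x y} hx hy => (hx.union hy).subset fun v hv => by
        by_contra hcon
        simp only [Set.mem_union, Set.mem_ofPred_eq, not_or, not_not] at hcon
        exact hv (Submodule.add_mem _ hcon.1 hcon.2)
      smul_mem' := fun c x hx => hx.subset fun v hv hcon => hv (Submodule.smul_mem _ c hcon) }
  apply_mem_toSubmodule σ x hx := by
    refine (hx.image (σ • ·)).subset fun v hv => ⟨σ⁻¹ • v, fun hcon => hv ?_, smul_inv_smul σ v⟩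
    exact galR_mem_localU ℓ σ _ v _ _ hcon

variable {K}

/-- The `S`-ideles `J_L^S = ∏_{v ∣ S} R_{L_v} × ∏_{v ∤ S} U_{L_v}` for a set `S` of places of `K`,
as a Galois module. -/
noncomputable def sIdeles [NumberField K] (S : Set (Place K)) : Subrepresentation
    (productRep ℓ : Representation ℤ_[ℓ] (L ≃ₐ[K] L) (∀ v : Place L, localR ℓ v)) where
  toSubmodule :=
    { carrier := {x | ∀ v : Place L, (∀ p ∈ S, ¬ v.LiesOver p) → x v ∈ localU ℓ v}
      zero_mem' := fun v _ => Submodule.zero_mem _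
      add_mem' := fun hx hy v hv => Submodule.add_mem _ (hx v hv) (hy v hv)
      smul_mem' := fun c x hx v hv => Submodule.smul_mem _ c (hx v hv) }
  apply_mem_toSubmodule σ x hx v hv :=
    galR_mem_localU ℓ σ _ v _ _ (hx _ fun p hp h => hv p hp (by
      simpa using h.smul σ))

end Ideles

section Ramification

variable {K : Type*} (L : Type*) [Field K] [NumberField K] [Field L] [NumberField L] [Algebra K L]

/-- A prime `p` of `K` is ramified in `L` if `e(P/p) ≠ 1` for some prime `P` of `L` over `p`. -/
def IsRamifiedPrime (p : HeightOneSpectrum (𝓞 K)) : Prop :=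
  ∃ P : HeightOneSpectrum (𝓞 L), P.asIdeal.LiesOver p.asIdeal ∧
    P.asIdeal.ramificationIdx (𝓞 K) ≠ 1

end Ramification

/-! ### Cohomology -/

section Cohomology

/-- The complex computing the Tate cohomology of a representation of a finite group. -/
noncomputable abbrev tateCx {k G : Type} [CommRing k] [Group G] [Finite G] (M : Rep.{0} k G) :
    CochainComplex (ModuleCat k) ℤ :=
  letI := Fintype.ofFinite G
  tateComplex M

/-- The Tate cohomology module `H^i(G, M)`: for `i = 0` it is `M^G / N_G M`, for `i ≥ 1` it is the
cohomology of `Hom_{k[G]}(F, M)` for a projective resolution `F` of `k` over `k[G]`. -/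
noncomputable abbrev tateH {k G : Type} [CommRing k] [Group G] [Finite G] (M : Rep.{0} k G)
    (i : ℤ) : ModuleCat k :=
  letI := Fintype.ofFinite G
  tateCohomology M i

/-- For a subgroup `H` of `G` and `f : M → N`, where `G` acts on `M` and `H` on `N`, this says that
`e : H^i(G, M) → H^i(H, N)` is restriction to `H` followed by the map induced by `f`: if a cocycle
`w` of `H` is the restriction to `H` of a cocycle `z` of `G`, composed with `f`, then `e` maps the
class of `z` to the class of `w`. -/
def IsRestriction {k G : Type} [CommRing k] [Group G] [Finite G] {H : Subgroup G}
    (M : Rep.{0} k G) (N : Rep.{0} k H) (f : M →ₗ[k] N) (i : ℕ)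
    (e : tateH M i →ₗ[k] tateH N i) : Prop :=
  ∀ (z : (tateCx M).cycles i) (w : (tateCx N).cycles i),
    (∀ h : Fin i → H, ((tateCx N).iCycles i w : (Fin i → H) → N) h =
      f (((tateCx M).iCycles i z : (Fin i → G) → M) (fun j => (h j : G)))) →
    e ((tateCx M).homologyπ i z) = (tateCx N).homologyπ i w

variable (ℓ : ℕ) [Fact ℓ.Prime] (K L : Type) [Field K] [Field L] [NumberField L] [Algebra K L]

/-- `J_L` as a `ℤ_ℓ[G]`-module. -/
noncomputable abbrev ideleRep : Rep.{0} ℤ_[ℓ] (L ≃ₐ[K] L) :=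
  Rep.of (ideles ℓ K L).toRepresentation

/-- `J_L^S` as a `ℤ_ℓ[G]`-module. -/
noncomputable abbrev sIdeleRep {K : Type} [Field K] [NumberField K] [Algebra K L]
    (S : Set (Place K)) : Rep.{0} ℤ_[ℓ] (L ≃ₐ[K] L) :=
  Rep.of (sIdeles ℓ L S).toRepresentation

/-- `R_{L_v}` as a `ℤ_ℓ[G_v]`-module, where `G_v` is the decomposition group of `v`. -/
noncomputable abbrev localRep {L : Type} [Field L] [NumberField L] [Algebra K L] (v : Place L) :
    Rep.{0} ℤ_[ℓ] (MulAction.stabilizer (L ≃ₐ[K] L) v) :=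
  Rep.of (decompositionRep ℓ v)

variable {K L}

/-- The projection `J_L → R_{L_v}`. -/
noncomputable def ideleProj (v : Place L) : ideleRep ℓ K L →ₗ[ℤ_[ℓ]] localRep ℓ K v :=
  LinearMap.proj (φ := fun u : Place L => localR ℓ u) v ∘ₗ
    (ideles ℓ K L).toSubmodule.subtype

/-- The projection `J_L^S → R_{L_v}`. -/
noncomputable def sIdeleProj [NumberField K] (S : Set (Place K)) (v : Place L) :
    sIdeleRep ℓ L S →ₗ[ℤ_[ℓ]] localRep ℓ K v :=
  LinearMap.proj (φ := fun u : Place L => localR ℓ u) v ∘ₗ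
    (sIdeles ℓ L S).toSubmodule.subtype

end Cohomology

end EllAdic

open EllAdic

/-! The group `G` permutes the factors of the product of all `R_{L_v}`, so the places above a fixed
`p` contribute a module induced from the decomposition group of the chosen place, and Shapiro's
lemma gives the local cohomology. What is specific to ideles is the finiteness: an idele is a unit
at almost all places, and outside `S` the module `U` has trivial `H^0` and `H^1`. Hence a class has
only finitely many nonzero local components, and local primitives can be taken in `U` at almost all
places and so assemble to an idele.

In degrees 0 and 1 this is done with explicit cochains. Surjectivity comes from `spread` and
`inducedCocycle`, which extend invariants and cocycles of the decomposition groups to all of `G`.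
Injectivity comes from `single`, which puts local primitives at the chosen places, together with
`ext_of_invariant` in degree 0 and `exists_coboundary_of_vanishing` in degree 1. `exists_tateH_zero`
and `exists_tateH_one` treat a family of places of `K` containing `S`; the family `S` itself gives
the `S`-ideles, the family of all places gives the ideles.

The local input concerns a prime `P` with `e = 1`, with valuation ring `O`. There the decomposition
group acts faithfully on the residue field and fixes a uniformizer. Independence of characters
modulo `P` gives a form of Hilbert 90 for the units of `O` (`exists_unit_coboundary`); surjectivity
of norm and trace in the residue field, successive approximation and compactness show that invariant
units are norms (`exists_prod_smul_eq_unit`). By compactness the units of `O` map onto `U`, and the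
kernel, the infinitely `ℓ`-divisible units, is uniquely `ℓ`-divisible. The cohomology of such a
kernel is killed by the prime-to-`ℓ` part of the group order, which is invertible in `ℤ_ℓ`; so both
vanishing statements descend to `U` (`exists_norm_eq_of_ker`, `exists_coboundary_of_ker`). -/

namespace EllAdic

/-! ### Cohomology of a complex as cocycles modulo coboundaries, compared with a direct sum. -/

section Homology

open CategoryTheory

variable {k : Type} [CommRing k] (C : CochainComplex (ModuleCat.{0} k) ℤ) {i j l : ℤ}

theorem homologyπ_surjective : Function.Surjective (C.homologyπ j).hom :=
  (ModuleCat.epi_iff_surjective _).1 inferInstance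

theorem iCycles_injective : Function.Injective (C.iCycles j).hom :=
  (ModuleCat.mono_iff_injective _).1 inferInstance

theorem homologyπ_eq_zero_iff (hij : i + 1 = j) (z : C.cycles j) :
    (C.homologyπ j).hom z = 0 ↔ ∃ b, (C.d i j).hom b = (C.iCycles j).hom z := by
  have hp : (ComplexShape.up ℤ).prev j = i := (ComplexShape.up ℤ).prev_eq' hij
  have hex : (ShortComplex.mk (C.toCycles i j) (C.homologyπ j) (C.toCycles_comp_homologyπ i j)).Exact :=
    ShortComplex.exact_of_g_is_cokernel _ (C.homologyIsCokernel i j hp)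
  rw [ShortComplex.moduleCat_exact_iff] at hex
  constructor
  · intro h
    obtain ⟨b, hb⟩ := hex z h
    refine ⟨b, ?_⟩
    rw [← hb, ← C.toCycles_i i j]
    rfl
  · rintro ⟨b, hb⟩
    have : (C.toCycles i j).hom b = z := by
      apply iCycles_injective
      rw [← hb, ← C.toCycles_i i j]
      rfl
    rw [← this]
    exact LinearMap.congr_fun (congrArg ModuleCat.Hom.hom (C.toCycles_comp_homologyπ i j)) b

theorem exists_iCycles_eq (hjl : j + 1 = l) (x : C.X j) (hx : (C.d j l).hom x = 0) :
    ∃ z, (C.iCycles j).hom z = x := by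
  have hn : (ComplexShape.up ℤ).next j = l := (ComplexShape.up ℤ).next_eq' hjl
  have hex : (ShortComplex.mk (C.iCycles j) (C.d j l) (C.iCycles_d j l)).Exact :=
    ShortComplex.exact_of_f_is_kernel _ (C.cyclesIsKernel j l hn)
  rw [ShortComplex.moduleCat_exact_iff] at hex
  exact hex x hx

theorem d_iCycles (z : C.cycles j) : (C.d j l).hom ((C.iCycles j).hom z) = 0 :=
  LinearMap.congr_fun (congrArg ModuleCat.Hom.hom (C.iCycles_d j l)) z

/-- The cycles of a complex of modules are the kernel of its differential. -/
noncomputable def cyclesEquivKer (hjl : j + 1 = l) :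
    C.cycles j ≃ₗ[k] LinearMap.ker (C.d j l).hom :=
  LinearEquiv.ofBijective ((C.iCycles j).hom.codRestrict _ fun z => d_iCycles C z)
    ⟨fun _ _ h => iCycles_injective C (congrArg Subtype.val h), fun x => by
      obtain ⟨z, hz⟩ := exists_iCycles_eq C hjl x.1 x.2
      exact ⟨z, Subtype.ext hz⟩⟩

theorem iCycles_cyclesEquivKer_symm (hjl : j + 1 = l) (x : LinearMap.ker (C.d j l).hom) :
    (C.iCycles j).hom ((cyclesEquivKer C hjl).symm x) = x :=
  congrArg Subtype.val ((cyclesEquivKer C hjl).apply_symm_apply x)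

/-- A family of maps of cochains in degree `j` which respects cocycles and coboundaries, detects
coboundaries, and hits every family of cocycles with finite support, induces an isomorphism from
the cohomology to the direct sum of the cohomologies. -/
theorem exists_homology_equiv_directSum {ι : Type} (D : ι → CochainComplex (ModuleCat.{0} k) ℤ)
    (hij : i + 1 = j) (hjl : j + 1 = l) (r : ∀ p, C.X j →ₗ[k] (D p).X j)
    (hcyc : ∀ p x, (C.d j l).hom x = 0 → ((D p).d j l).hom (r p x) = 0)
    (hbd : ∀ p b, ∃ b', ((D p).d i j).hom b' = r p ((C.d i j).hom b))
    (hfin : ∀ x, (C.d j l).hom x = 0 → {p | ¬ ∃ b, ((D p).d i j).hom b = r p x}.Finite)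
    (hinj : ∀ x, (C.d j l).hom x = 0 → (∀ p, ∃ b, ((D p).d i j).hom b = r p x) →
      ∃ b, (C.d i j).hom b = x)
    (hsurj : ∀ w : ∀ p, (D p).X j, (∀ p, ((D p).d j l).hom (w p) = 0) → {p | w p ≠ 0}.Finite →
      ∃ x, (C.d j l).hom x = 0 ∧ ∀ p, r p x = w p) :
    ∃ e : C.homology j ≃ₗ[k] DirectSum ι (fun p => (D p).homology j), ∀ p z w,
      ((D p).iCycles j).hom w = r p ((C.iCycles j).hom z) →
      DirectSum.component k _ _ p (e ((C.homologyπ j).hom z)) = ((D p).homologyπ j).hom w := by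
  classical
  let ψ : ∀ p, C.cycles j →ₗ[k] (D p).homology j := fun p =>
    ((D p).homologyπ j).hom ∘ₗ (cyclesEquivKer (D p) hjl).symm.toLinearMap ∘ₗ
      (r p).restrict (fun x hx => hcyc p x hx) ∘ₗ (cyclesEquivKer C hjl).toLinearMap
  have hψ : ∀ p z w, ((D p).iCycles j).hom w = r p ((C.iCycles j).hom z) →
      ψ p z = ((D p).homologyπ j).hom w := by
    intro p z w h
    change ((D p).homologyπ j).hom _ = _
    congr 1
    apply iCycles_injective
    change ((D p).iCycles j).hom ((cyclesEquivKer (D p) hjl).symm _) = _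
    rw [iCycles_cyclesEquivKer_symm, h]
    rfl
  have hψ0 : ∀ p z, ψ p z = 0 ↔ ∃ b, ((D p).d i j).hom b = r p ((C.iCycles j).hom z) := by
    intro p z
    obtain ⟨w, hw⟩ := exists_iCycles_eq (D p) hjl _ (hcyc p _ (d_iCycles C z))
    rw [hψ p z w hw, homologyπ_eq_zero_iff (D p) hij, hw]
  let F : DirectSum ι (fun p => (D p).homology j) →ₗ[k] ∀ p, (D p).homology j :=
    DFinsupp.coeFnLinearMap k
  have hF : Function.Injective F := DFunLike.coe_injective
  have hFr : ∀ f : ∀ p, (D p).homology j, {p | f p ≠ 0}.Finite → f ∈ LinearMap.range F := by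
    intro f hf
    refine ⟨(DFinsupp.mk hf.toFinset fun p => f p : Π₀ p, (D p).homology j), funext fun p => ?_⟩
    change (DFinsupp.mk hf.toFinset (fun p => f p) : Π₀ p, (D p).homology j) p = f p
    rw [DFinsupp.mk_apply]
    split_ifs with h
    · rfl
    · simpa [eq_comm] using h
  -- The direct sum is identified with the families of finite support in the product, so that a map
  -- into it can be given by its components.
  let Ψ : C.cycles j →ₗ[k] DirectSum ι (fun p => (D p).homology j) :=
    (LinearEquiv.ofInjective F hF).symm.toLinearMap ∘ₗ
      (LinearMap.pi ψ).codRestrict (LinearMap.range F) fun z => hFr _ (by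
        refine (hfin _ (d_iCycles C z)).subset fun p hp hcon => hp ?_
        exact (hψ0 p z).2 hcon)
  have hΨ : ∀ z p, F (Ψ z) p = ψ p z := fun z p =>
    congrFun (congrArg Subtype.val ((LinearEquiv.ofInjective F hF).apply_symm_apply _)) p
  have hker : LinearMap.ker (C.homologyπ j).hom = LinearMap.ker Ψ := by
    ext z
    rw [LinearMap.mem_ker, LinearMap.mem_ker, homologyπ_eq_zero_iff C hij]
    constructor
    · rintro ⟨b, hb⟩
      apply hF
      funext p
      rw [hΨ, map_zero, Pi.zero_apply, hψ0, ← hb]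
      exact hbd p b
    · intro h
      refine hinj _ (d_iCycles C z) fun p => ?_
      rw [← hψ0, ← hΨ, h, map_zero, Pi.zero_apply]
  have hsur : Function.Surjective Ψ := by
    intro y
    choose w hw using fun p => homologyπ_surjective (D p) (F y p)
    -- Only the classes have finite support, whereas `hsurj` needs cocycles with finite support; the
    -- representative is therefore reset to 0 wherever the class vanishes.
    let w' : ∀ p, (D p).cycles j := fun p => if F y p = 0 then 0 else w p
    have hw' : ∀ p, ((D p).homologyπ j).hom (w' p) = F y p := by
      intro p
      by_cases h : F y p = 0
      · simp [w', h]
      · simp [w', h, hw]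
    obtain ⟨x, hx, hxr⟩ := hsurj (fun p => ((D p).iCycles j).hom (w' p))
      (fun p => d_iCycles (D p) (w' p)) (by
        refine (DFinsupp.finite_support y).subset fun p hp hcon => hp ?_
        have : F y p = 0 := hcon
        simp [w', this])
    obtain ⟨z, hz⟩ := exists_iCycles_eq C hjl x hx
    refine ⟨z, hF (funext fun p => ?_)⟩
    rw [hΨ, hψ p z (w' p) (by rw [hz, hxr]), hw']
  refine ⟨(LinearMap.quotKerEquivOfSurjective _ (homologyπ_surjective C)).symm ≪≫ₗ
    Submodule.quotEquivOfEq _ _ hker ≪≫ₗ LinearMap.quotKerEquivOfSurjective Ψ hsur,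
    fun p z w h => ?_⟩
  have : (LinearMap.quotKerEquivOfSurjective _ (homologyπ_surjective C)).symm
      ((C.homologyπ j).hom z) = Submodule.Quotient.mk z := by
    rw [LinearEquiv.symm_apply_eq]
    rfl
  rw [LinearEquiv.trans_apply, LinearEquiv.trans_apply, this]
  exact (hΨ z p).trans (hψ p z w h)

end Homology

/-! ### The Tate complex in degrees -1 to 2. -/

section Cochains
open CategoryTheory

variable {k G : Type} [CommRing k] [Group G] (M : Rep.{0} k G)

theorem inhomogeneousCochains_d_zero_apply (x : (Fin 0 → G) → M) (g : Fin 1 → G) :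
    (inhomogeneousCochains.d M 0).hom x g = M.ρ (g 0) (x Fin.elim0) - x Fin.elim0 := by
  rw [inhomogeneousCochains.d_hom_apply, Fin.sum_univ_one, sub_eq_add_neg,
    Subsingleton.elim (fun i : Fin 0 => g i.succ) Fin.elim0, Subsingleton.elim (Fin.contractNth _ _ _) Fin.elim0]
  simp

theorem inhomogeneousCochains_d_one_apply (x : (Fin 1 → G) → M) (g : Fin 2 → G) :
    (inhomogeneousCochains.d M 1).hom x g =
      M.ρ (g 0) (x fun _ => g 1) - x (fun _ => g 0 * g 1) + x fun _ => g 0 := by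
  have h0 : (fun i : Fin 1 => g i.succ) = fun _ => g 1 := funext fun i => by
    rw [Subsingleton.elim i 0]; rfl
  have h1 : Fin.contractNth 0 (· * ·) g = fun _ => g 0 * g 1 := funext fun i => by
    rw [Subsingleton.elim i 0]; rfl
  have h2 : Fin.contractNth 1 (· * ·) g = fun _ => g 0 := funext fun i => by
    rw [Subsingleton.elim i 0]; rfl
  rw [inhomogeneousCochains.d_hom_apply, Fin.sum_univ_two, h0, h1, h2]
  simp [sub_eq_add_neg, add_assoc]

variable [Finite G]

theorem tateCx_d_zero_eq_zero_iff (x : (Fin 0 → G) → M) :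
    ((tateCx M).d 0 1).hom x = 0 ↔ ∀ g, M.ρ g (x Fin.elim0) = x Fin.elim0 := by
  change ((groupCohomology.inhomogeneousCochains M).d 0 1).hom x = 0 ↔ _
  rw [groupCohomology.inhomogeneousCochains.d_def]
  refine ⟨fun h g => ?_, fun h => funext fun g => ?_⟩
  · have := congrFun h (fun _ => g)
    rwa [inhomogeneousCochains_d_zero_apply, Pi.zero_apply, sub_eq_zero] at this
  · rw [inhomogeneousCochains_d_zero_apply, h, sub_self]; rfl

theorem tateCx_d_one_eq_zero_iff (x : (Fin 1 → G) → M) :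
    ((tateCx M).d 1 2).hom x = 0 ↔
      ∀ g h, x (fun _ => g * h) = M.ρ g (x fun _ => h) + x fun _ => g := by
  change ((groupCohomology.inhomogeneousCochains M).d 1 2).hom x = 0 ↔ _
  rw [groupCohomology.inhomogeneousCochains.d_def]
  have key : ∀ a b c : M, a - b + c = 0 ↔ b = a + c := fun a b c => by
    rw [sub_add_eq_add_sub, sub_eq_zero, eq_comm]
  refine ⟨fun h g g' => ?_, fun h => funext fun g => ?_⟩
  · have := congrFun h ![g, g']
    rw [inhomogeneousCochains_d_one_apply, Pi.zero_apply] at this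
    exact (key _ _ _).1 this
  · rw [inhomogeneousCochains_d_one_apply]
    exact (key _ _ _).2 (h _ _)

theorem exists_tateCx_d_zero_eq_iff (x : (Fin 1 → G) → M) :
    (∃ b, ((tateCx M).d 0 1).hom b = x) ↔ ∃ m, ∀ g, M.ρ g m - m = x fun _ => g := by
  change (∃ b, ((groupCohomology.inhomogeneousCochains M).d 0 1).hom b = x) ↔ _
  rw [groupCohomology.inhomogeneousCochains.d_def]
  constructor
  · rintro ⟨b, rfl⟩
    exact ⟨b Fin.elim0, fun g => (inhomogeneousCochains_d_zero_apply M b fun _ => g).symm⟩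
  · rintro ⟨m, hm⟩
    refine ⟨fun _ => m, funext fun g => ?_⟩
    rw [inhomogeneousCochains_d_zero_apply, hm]
    exact congrArg x (funext fun i => by rw [Subsingleton.elim i 0])

/-- The chains in degree -1 are finitely supported functions on the one-point set `Fin 0 → G`, and
the differential leaving them is the norm. Writing it as a `finsum` frees the statement from the
choice of a `Fintype` structure on `G`. -/
theorem exists_tateCx_d_neg_one_eq_iff (x : (Fin 0 → G) → M) :
    (∃ b, ((tateCx M).d (-1) 0).hom b = x) ↔ ∃ m, ∑ᶠ g, M.ρ g m = x Fin.elim0 := by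
  let := Fintype.ofFinite G
  change (∃ b, (M.tateNorm).hom b = x) ↔ _
  rw [Rep.tateNorm_eq]
  simp only [finsum_eq_sum_of_fintype]
  constructor
  · rintro ⟨b, rfl⟩
    refine ⟨b Fin.elim0, ?_⟩
    have hb : b = Finsupp.single Fin.elim0 (b Fin.elim0) := by
      refine Finsupp.ext fun i => ?_
      rw [Subsingleton.elim i Fin.elim0, Finsupp.single_eq_same]
    conv_rhs => rw [hb]
    simp [Representation.norm]
  · rintro ⟨m, hm⟩
    refine ⟨Finsupp.single Fin.elim0 m, funext fun g => ?_⟩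
    rw [Subsingleton.elim g Fin.elim0, ← hm]
    simp [Representation.norm]

end Cochains

/-! ### Criteria for restriction to be an isomorphism onto a direct sum. -/

section Restriction

variable {k G ι : Type} [CommRing k] [Group G] [Finite G] (M : Rep.{0} k G) (H : ι → Subgroup G)
  (N : ∀ p, Rep.{0} k (H p)) (f : ∀ p, M →ₗ[k] N p)
  (hf : ∀ p (h : H p) m, f p (M.ρ h m) = (N p).ρ h (f p m))

include hf in
/-- A criterion for restriction to induce an isomorphism from `H^0` to a direct sum of `H^0`s. -/
theorem exists_tateH_zero_equiv
    (hN : ∀ p m, ∃ n, ∑ᶠ h, (N p).ρ h n = f p (∑ᶠ g, M.ρ g m))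
    (hfin : ∀ x, (∀ g, M.ρ g x = x) → {p | ¬ ∃ n, ∑ᶠ h, (N p).ρ h n = f p x}.Finite)
    (hinj : ∀ x, (∀ g, M.ρ g x = x) → (∀ p, ∃ n, ∑ᶠ h, (N p).ρ h n = f p x) →
      ∃ m, ∑ᶠ g, M.ρ g m = x)
    (hsurj : ∀ w : ∀ p, N p, (∀ p h, (N p).ρ h (w p) = w p) → {p | w p ≠ 0}.Finite →
      ∃ x, (∀ g, M.ρ g x = x) ∧ ∀ p, f p x = w p) :
    ∃ e : tateH M (0 : ℕ) ≃ₗ[k] DirectSum ι (fun p => tateH (N p) (0 : ℕ)),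
      ∀ p, IsRestriction M (N p) (f p) 0 (DirectSum.component k _ _ p ∘ₗ e.toLinearMap) := by
  let r : ∀ p, ((Fin 0 → G) → M) →ₗ[k] ((Fin 0 → H p) → N p) := fun p =>
    LinearMap.pi fun h => f p ∘ₗ LinearMap.proj fun j => (h j : G)
  have hr : ∀ p x, r p x Fin.elim0 = f p (x Fin.elim0) := fun p x =>
    congrArg (fun t => f p (x t)) (Subsingleton.elim _ _)
  obtain ⟨e, he⟩ := exists_homology_equiv_directSum (i := -1) (j := 0) (l := 1) (tateCx M)
    (fun p => tateCx (N p)) (by norm_num) (by norm_num) r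
    (fun p x hx => (tateCx_d_zero_eq_zero_iff (N p) (r p x)).2 fun h =>
      (congrArg ((N p).ρ h) (hr p x)).trans ((hf p h _).symm.trans ((congrArg (f p)
        ((tateCx_d_zero_eq_zero_iff M x).1 hx h)).trans (hr p x).symm)))
    -- No map of chains in degree -1 is used: all that is needed is that the restriction of a norm
    -- from `G` is again a norm, which is `hN`.
    (fun p b => (exists_tateCx_d_neg_one_eq_iff (N p) (r p _)).2 (by
      obtain ⟨m, hm⟩ := (exists_tateCx_d_neg_one_eq_iff M _).1 ⟨b, rfl⟩
      obtain ⟨n, hn⟩ := hN p m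
      exact ⟨n, hn.trans ((congrArg (f p) hm).trans (hr p _).symm)⟩))
    (fun x hx => (hfin _ ((tateCx_d_zero_eq_zero_iff M x).1 hx)).subset fun p hp hcon => hp
      ((exists_tateCx_d_neg_one_eq_iff (N p) (r p x)).2 (hcon.imp fun n hn => hn.trans (hr p x).symm)))
    (fun x hx hp => (exists_tateCx_d_neg_one_eq_iff M x).2
      (hinj _ ((tateCx_d_zero_eq_zero_iff M x).1 hx) fun p =>
        ((exists_tateCx_d_neg_one_eq_iff (N p) (r p x)).1 (hp p)).imp fun n hn =>
          hn.trans (hr p x)))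
    (fun w hw hwf => by
      obtain ⟨x, hx, hxw⟩ := hsurj (fun p => (w p : (Fin 0 → H p) → N p) Fin.elim0)
        (fun p => (tateCx_d_zero_eq_zero_iff (N p) (w p)).1 (hw p))
        (hwf.subset fun p hp hcon => hp (congrFun hcon Fin.elim0))
      refine ⟨fun _ => x, (tateCx_d_zero_eq_zero_iff M _).2 hx, fun p => funext fun t => ?_⟩
      rw [Subsingleton.elim t Fin.elim0]
      exact hxw p)
  exact ⟨e, fun p z w h => he p z w (funext h)⟩

include hf in
/-- A criterion for restriction to induce an isomorphism from `H^1` to a direct sum of `H^1`s. -/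
theorem exists_tateH_one_equiv
    (hfin : ∀ x : G → M, (∀ g h, x (g * h) = M.ρ g (x h) + x g) →
      {p | ¬ ∃ n, ∀ h : H p, (N p).ρ h n - n = f p (x h)}.Finite)
    (hinj : ∀ x : G → M, (∀ g h, x (g * h) = M.ρ g (x h) + x g) →
      (∀ p, ∃ n, ∀ h : H p, (N p).ρ h n - n = f p (x h)) → ∃ m, ∀ g, M.ρ g m - m = x g)
    (hsurj : ∀ w : ∀ p, H p → N p, (∀ p g h, w p (g * h) = (N p).ρ g (w p h) + w p g) →
      {p | w p ≠ 0}.Finite →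
      ∃ x : G → M, (∀ g h, x (g * h) = M.ρ g (x h) + x g) ∧ ∀ p (h : H p), f p (x h) = w p h) :
    ∃ e : tateH M (1 : ℕ) ≃ₗ[k] DirectSum ι (fun p => tateH (N p) (1 : ℕ)),
      ∀ p, IsRestriction M (N p) (f p) 1 (DirectSum.component k _ _ p ∘ₗ e.toLinearMap) := by
  let r : ∀ p, ((Fin 1 → G) → M) →ₗ[k] ((Fin 1 → H p) → N p) := fun p =>
    LinearMap.pi fun h => f p ∘ₗ LinearMap.proj fun j => (h j : G)
  have hr : ∀ p x (h : H p), r p x (fun _ => h) = f p (x fun _ => h) := fun p x h => rfl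
  have h1 : ∀ {A : Type} (t : Fin 1 → A), t = fun _ => t 0 := fun t => funext fun i => by
    rw [Subsingleton.elim i 0]
  obtain ⟨e, he⟩ := exists_homology_equiv_directSum (i := 0) (j := 1) (l := 2) (tateCx M)
    (fun p => tateCx (N p)) (by norm_num) (by norm_num) r
    (fun p x hx => (tateCx_d_one_eq_zero_iff (N p) (r p x)).2 fun g h =>
      (congrArg (f p) ((tateCx_d_one_eq_zero_iff M x).1 hx g h)).trans
        ((map_add (f p) _ _).trans (congrArg (· + _) (hf p g _))))
    (fun p b => (exists_tateCx_d_zero_eq_iff (N p) (r p _)).2 (by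
      obtain ⟨m, hm⟩ := (exists_tateCx_d_zero_eq_iff M _).1 ⟨b, rfl⟩
      refine ⟨f p m, fun g => ?_⟩
      rw [← hf, ← map_sub, hm]
      rfl))
    (fun x hx => (hfin (fun g => (x : (Fin 1 → G) → M) fun _ => g)
      ((tateCx_d_one_eq_zero_iff M x).1 hx)).subset fun p hp hcon => hp
        ((exists_tateCx_d_zero_eq_iff (N p) (r p x)).2 hcon))
    (fun x hx hp => (exists_tateCx_d_zero_eq_iff M x).2
      (hinj (fun g => (x : (Fin 1 → G) → M) fun _ => g) ((tateCx_d_one_eq_zero_iff M x).1 hx)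
        fun p => (exists_tateCx_d_zero_eq_iff (N p) (r p x)).1 (hp p)))
    (fun w hw hwf => by
      obtain ⟨x, hx, hxw⟩ := hsurj (fun p h => (w p : (Fin 1 → H p) → N p) fun _ => h)
        (fun p => (tateCx_d_one_eq_zero_iff (N p) (w p)).1 (hw p))
        (hwf.subset fun p hp hcon => hp (by
          funext h
          exact congrFun hcon fun _ => h))
      refine ⟨fun g => x (g 0), (tateCx_d_one_eq_zero_iff M _).2 hx, fun p => funext fun t => ?_⟩
      rw [h1 t]
      exact hxw p _)
  exact ⟨e, fun p z w h => he p z w (funext h)⟩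

end Restriction
-- Extension of families by zero, and norms along a subgroup.
section FamilyExtension

/-- Serves to extend local data from a family of places of `K` to all of them, with value 0
elsewhere. -/
theorem exists_extension_of_injective {ι Y : Type*} {A : Y → Type*} [∀ y, Zero (A y)] {j : ι → Y}
    (hj : Function.Injective j) (w : ∀ i, A (j i)) :
    ∃ w' : ∀ y, A y, (∀ i, w' (j i) = w i) ∧ ∀ y, y ∉ Set.range j → w' y = 0 := by
  classical
  refine ⟨fun y => if h : ∃ i, j i = y then h.choose_spec ▸ w h.choose else 0, fun i => ?_,
    fun y hy => dif_neg hy⟩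
  have h : ∃ i', j i' = j i := ⟨i, rfl⟩
  -- The chosen preimage is generalized to a variable, so that injectivity can replace it by `i` and
  -- the cast disappears.
  have key : ∀ (i' : ι) (e : j i' = j i), (e ▸ w i' : A (j i)) = w i := by
    intro i' e
    obtain rfl := hj e
    rfl
  exact (dif_pos h).trans (key _ _)

theorem finsum_eq_finsum_subgroup {G A : Type*} [Group G] [AddCommMonoid A] (H : Subgroup G)
    (F : G → A) (hF : ∀ g ∉ H, F g = 0) : ∑ᶠ g, F g = ∑ᶠ h : H, F h := by
  rw [show (∑ᶠ h : H, F h) = ∑ᶠ g ∈ (H : Set G), F g from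
    finsum_set_coe_eq_finsum_mem (H : Set G)]
  refine finsum_congr fun g => ?_
  by_cases hg : g ∈ (H : Set G)
  · simp [hg]
  · simp [hg, hF g hg]

/-- The sum over `G` splits along the cosets of `H`; this is why norms from `G` restrict to norms
from a decomposition group. -/
theorem exists_finsum_eq_finsum_subgroup {k G M : Type*} [CommRing k] [Group G] [Finite G]
    [AddCommGroup M] [Module k M] (ρ : Representation k G M) (H : Subgroup G) (m : M) :
    ∃ m', ∑ᶠ g, ρ g m = ∑ᶠ h : H, ρ h m' := by
  classical
  have := Fintype.ofFinite G
  have := Fintype.ofFinite H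
  have := Fintype.ofFinite (G ⧸ H)
  have hbij : Function.Bijective fun x : (G ⧸ H) × H => x.1.out * (x.2 : G) := by
    constructor
    · rintro ⟨q, h⟩ ⟨q', h'⟩ e
      have hq : q = q' := by
        have := congrArg (QuotientGroup.mk (s := H)) e
        simpa only [QuotientGroup.mk_mul_of_mem _ (Subtype.prop _), QuotientGroup.out_eq'] using this
      subst hq
      exact Prod.ext rfl (Subtype.ext (mul_left_cancel e))
    · intro g
      exact ⟨(QuotientGroup.mk g, ⟨(QuotientGroup.mk g : G ⧸ H).out⁻¹ * g,
        QuotientGroup.eq.1 (QuotientGroup.out_eq' _)⟩), mul_inv_cancel_left _ _⟩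
  -- Inverting `g = q.out * h` gives `g⁻¹ = h⁻¹ * q.out⁻¹`, so the inverses of left coset
  -- representatives are the right ones to sum over.
  refine ⟨∑ q : G ⧸ H, ρ (q.out⁻¹) m, ?_⟩
  rw [finsum_eq_sum_of_fintype, finsum_eq_sum_of_fintype, ← Equiv.sum_comp (Equiv.inv G),
    ← Equiv.sum_comp (Equiv.ofBijective _ hbij), Fintype.sum_prod_type_right,
    ← Equiv.sum_comp (Equiv.inv H)]
  refine Finset.sum_congr rfl fun h _ => ?_
  rw [map_sum]
  refine Finset.sum_congr rfl fun q _ => ?_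
  rw [← Module.End.mul_apply, ← map_mul]
  simp

end FamilyExtension

/-! ### Shapiro's lemma for the permuted product of the local modules. -/

section Induction

variable {ℓ : ℕ} [Fact ℓ.Prime] {K L : Type} [Field K] [Field L] [NumberField L] [Algebra K L]

/-- The form with a free place `u` avoids casts between the local modules at `u` and at `σ⁻¹ • v`.
-/
theorem productRep_apply_of_smul_eq (σ : L ≃ₐ[K] L) (x : ∀ v : Place L, localR ℓ v)
    (u v : Place L) (h : σ • u = v) : productRep ℓ σ x v = galR ℓ σ u v h (x u) := by
  obtain rfl : σ⁻¹ • v = u := by rw [← h, inv_smul_smul]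
  rfl

theorem galR_congr {σ τ : L ≃ₐ[K] L} (h : σ = τ) (u v : Place L) (hσ : σ • u = v) (hτ : τ • u = v)
    (x : localR ℓ u) : galR ℓ σ u v hσ x = galR ℓ τ u v hτ x := by
  subst h; rfl

section Component

variable (J : Subrepresentation (productRep ℓ : Representation ℤ_[ℓ] (L ≃ₐ[K] L)
  (∀ v : Place L, localR ℓ v)))

/-- The projection from a submodule of the product of the `R_{L_v}` to a component. -/
noncomputable def component (v : Place L) :
    Rep.of J.toRepresentation →ₗ[ℤ_[ℓ]] localRep ℓ K v :=
  LinearMap.proj (φ := fun u : Place L => localR ℓ u) v ∘ₗ J.toSubmodule.subtype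

theorem component_ρ (v : Place L) (h : MulAction.stabilizer (L ≃ₐ[K] L) v)
    (m : Rep.of J.toRepresentation) :
    component J v ((Rep.of J.toRepresentation).ρ h m) = (localRep ℓ K v).ρ h (component J v m) :=
  productRep_apply_of_smul_eq _ _ _ _ h.2

end Component

variable [NumberField K]

/-- A family of representatives `P p` of the places of `L` over the places `p` of `K`, with
an automorphism carrying `P p` to `v` for every `v` over `p`. -/
structure PlaceSystem (K L : Type) [Field K] [NumberField K] [Field L] [NumberField L]
    [Algebra K L] where
  rep : Place K → Place L
  liesOver_rep : ∀ p, (rep p).LiesOver p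
  below : Place L → Place K
  liesOver_below : ∀ v : Place L, v.LiesOver (below v)
  below_eq : ∀ {v : Place L} {p : Place K}, v.LiesOver p → below v = p
  trans : Place L → Place K → L ≃ₐ[K] L
  trans_smul : ∀ {v : Place L} {p : Place K}, v.LiesOver p → trans v p • rep p = v
  trans_rep : ∀ p, trans (rep p) p = 1

namespace PlaceSystem

variable (E : PlaceSystem K L)

theorem rep_injective : Function.Injective E.rep := fun p q h => by
  rw [← E.below_eq (E.liesOver_rep p), h, E.below_eq (E.liesOver_rep q)]

theorem below_rep (p : Place K) : E.below (E.rep p) = p := E.below_eq (E.liesOver_rep p)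

theorem finite_liesOver [FiniteDimensional K L] {A : Set (Place K)} (hA : A.Finite) :
    {v : Place L | E.below v ∈ A}.Finite := by
  refine (hA.biUnion (t := fun p => Set.range fun σ : L ≃ₐ[K] L => σ • E.rep p)
    fun p _ => Set.finite_range _).subset fun v hv => ?_
  exact Set.mem_biUnion hv ⟨_, E.trans_smul (E.liesOver_below v)⟩

open Classical in
/-- The element of the product supported at the chosen places. -/
noncomputable def single (y : ∀ p, localR ℓ (E.rep p)) (v : Place L) : localR ℓ v :=
  if h : v = E.rep (E.below v) then
    -- The identity automorphism serves as the transport between the local modules at two equal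
    -- places.
    galR ℓ (1 : L ≃ₐ[K] L) (E.rep (E.below v)) v (by rw [one_smul, ← h]) (y (E.below v)) else 0

theorem single_rep (y : ∀ p, localR ℓ (E.rep p)) (p : Place K) :
    E.single y (E.rep p) = y p := by
  have key : ∀ (q : Place K) (_ : q = p) (h : (1 : L ≃ₐ[K] L) • E.rep q = E.rep p),
      galR ℓ 1 (E.rep q) (E.rep p) h (y q) = y p := by
    rintro q rfl h
    exact galR_one ℓ _ h _
  unfold single
  rw [dif_pos (by rw [below_rep])]
  exact key _ (E.below_rep p) _

theorem single_of_ne (y : ∀ p, localR ℓ (E.rep p)) (v : Place L) (h : ∀ p, v ≠ E.rep p) :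
    E.single y v = 0 := dif_neg (h _)

/-- The term of `g` at `rep p` comes from the component at `g⁻¹ • rep p`. This place lies over `p`,
so it is a chosen place only if `g` stabilizes `rep p`; all other terms vanish. -/
theorem finsum_productRep_single_rep [FiniteDimensional K L] (y : ∀ p, localR ℓ (E.rep p))
    (p : Place K) :
    (∑ᶠ g : L ≃ₐ[K] L, productRep ℓ g (E.single y)) (E.rep p) =
      ∑ᶠ h, decompositionRep (K := K) ℓ (E.rep p) h (y p) := by
  have hev : (∑ᶠ g : L ≃ₐ[K] L, productRep ℓ g (E.single y)) (E.rep p) =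
      ∑ᶠ g : L ≃ₐ[K] L, productRep ℓ g (E.single y) (E.rep p) :=
    map_finsum (LinearMap.proj (R := ℤ_[ℓ]) (φ := fun v => localR ℓ v) (E.rep p))
      (Set.toFinite _)
  rw [hev, finsum_eq_finsum_subgroup (MulAction.stabilizer (L ≃ₐ[K] L) (E.rep p))]
  · refine finsum_congr fun h => ?_
    rw [productRep_apply_of_smul_eq _ _ _ _ h.2, single_rep]
    rfl
  · intro g hg
    rw [productRep_apply, single_of_ne, map_zero]
    intro q hq
    have hpq : p = q := by
      rw [← E.below_eq (E.liesOver_rep q), ← hq]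
      exact (E.below_eq ((E.liesOver_rep p).smul _)).symm
    subst hpq
    exact hg ((Subgroup.inv_mem_iff _).1 hq)

/-- An invariant element is determined by its components at the chosen places. -/
theorem ext_of_invariant {x y : ∀ v : Place L, localR ℓ v}
    (hx : ∀ g : L ≃ₐ[K] L, productRep ℓ g x = x) (hy : ∀ g : L ≃ₐ[K] L, productRep ℓ g y = y)
    (h : ∀ p, x (E.rep p) = y (E.rep p)) : x = y := by
  funext v
  have hv := E.trans_smul (E.liesOver_below v)
  rw [← hx (E.trans v (E.below v)), ← hy (E.trans v (E.below v)),
    productRep_apply_of_smul_eq _ _ _ _ hv, productRep_apply_of_smul_eq _ _ _ _ hv, h]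

/-- The element of the product with given components at the chosen places that is as invariant as
possible. -/
noncomputable def spread (x : ∀ p, localR ℓ (E.rep p)) (v : Place L) : localR ℓ v :=
  galR ℓ (E.trans v (E.below v)) _ v (E.trans_smul (E.liesOver_below v)) (x (E.below v))

/-- Two automorphisms carrying `rep p` to `v` differ by an element of the decomposition group, which
fixes `x p`. -/
theorem spread_eq {x : ∀ p, localR ℓ (E.rep p)}
    (hx : ∀ p h, decompositionRep (K := K) ℓ (E.rep p) h (x p) = x p) (v : Place L) (p : Place K)
    (σ : L ≃ₐ[K] L) (h : σ • E.rep p = v) : E.spread x v = galR ℓ σ _ v h (x p) := by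
  have hv : v.LiesOver p := h ▸ (E.liesOver_rep p).smul σ
  obtain rfl := E.below_eq hv
  have hs := E.trans_smul (E.liesOver_below v)
  have hstab : σ⁻¹ * E.trans v (E.below v) ∈
      MulAction.stabilizer (L ≃ₐ[K] L) (E.rep (E.below v)) := by
    rw [MulAction.mem_stabilizer_iff, mul_smul, hs, inv_smul_eq_iff, h]
  rw [← hx _ ⟨_, hstab⟩]
  exact (galR_galR ℓ _ _ _ (by simp) _ _ _ hstab h hs _).symm

theorem spread_rep {x : ∀ p, localR ℓ (E.rep p)}
    (hx : ∀ p h, decompositionRep (K := K) ℓ (E.rep p) h (x p) = x p) (p : Place K) :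
    E.spread x (E.rep p) = x p := by
  rw [E.spread_eq hx _ p 1 (one_smul _ _), galR_one]

theorem productRep_spread {x : ∀ p, localR ℓ (E.rep p)}
    (hx : ∀ p h, decompositionRep (K := K) ℓ (E.rep p) h (x p) = x p) (σ : L ≃ₐ[K] L) :
    productRep ℓ σ (E.spread x) = E.spread x := by
  funext v
  have hs := E.trans_smul (E.liesOver_below v)
  have h : (σ⁻¹ * E.trans v (E.below v)) • E.rep (E.below v) = σ⁻¹ • v := by
    rw [mul_smul, hs]
  rw [productRep_apply, E.spread_eq hx _ _ _ h, E.spread_eq hx v _ _ hs]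
  exact galR_galR ℓ _ _ _ (by simp) _ _ _ _ _ _ _

/-- The cocycle induced from cocycles of the decomposition groups. -/
noncomputable def inducedCocycle
    (c : ∀ p, MulAction.stabilizer (L ≃ₐ[K] L) (E.rep p) → localR ℓ (E.rep p))
    (τ : L ≃ₐ[K] L) (v : Place L) : localR ℓ v :=
  galR ℓ (E.trans v (E.below v)) _ v (E.trans_smul (E.liesOver_below v))
    (c (E.below v) ⟨(E.trans v (E.below v))⁻¹ * τ * E.trans (τ⁻¹ • v) (E.below v), by
      rw [MulAction.mem_stabilizer_iff, mul_smul, mul_smul,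
        E.trans_smul ((E.liesOver_below v).smul τ⁻¹), smul_inv_smul, inv_smul_eq_iff,
        E.trans_smul (E.liesOver_below v)]⟩)

/-- With `p` and `g` as variables, the value can be rewritten at places for which `below v` equals
`p` only propositionally. -/
theorem inducedCocycle_eq
    (c : ∀ p, MulAction.stabilizer (L ≃ₐ[K] L) (E.rep p) → localR ℓ (E.rep p))
    (τ : L ≃ₐ[K] L) (v : Place L) (p : Place K) (h : E.trans v p • E.rep p = v)
    (g : MulAction.stabilizer (L ≃ₐ[K] L) (E.rep p))
    (hg : (g : L ≃ₐ[K] L) = (E.trans v p)⁻¹ * τ * E.trans (τ⁻¹ • v) p) :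
    E.inducedCocycle c τ v = galR ℓ (E.trans v p) _ v h (c p g) := by
  have hv : v.LiesOver p := h ▸ (E.liesOver_rep p).smul _
  obtain rfl := E.below_eq hv
  obtain ⟨g, hg'⟩ := g
  obtain rfl : g = _ := hg
  rfl

/-- The normalization `trans_rep` makes the restriction equal to `c p` on the nose, not merely up to
a coboundary. -/
theorem inducedCocycle_rep
    (c : ∀ p, MulAction.stabilizer (L ≃ₐ[K] L) (E.rep p) → localR ℓ (E.rep p)) (p : Place K)
    (h : MulAction.stabilizer (L ≃ₐ[K] L) (E.rep p)) :
    E.inducedCocycle c h (E.rep p) = c p h := by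
  have h1 : (h : L ≃ₐ[K] L)⁻¹ • E.rep p = E.rep p := h⁻¹.2
  rw [E.inducedCocycle_eq c _ _ p (E.trans_smul (E.liesOver_rep p)) h (by
    rw [h1, trans_rep]; simp), galR_congr (E.trans_rep p) _ _ _ (one_smul _ _), galR_one]

/-- Let `s`, `t`, `r` be the chosen automorphisms carrying `rep p` to `v`, `σ⁻¹ • v` and `τ⁻¹ • σ⁻¹
• v`. Then `s⁻¹στr = (s⁻¹σt)(t⁻¹τr)` is a product in the decomposition group, and the relation for
`c p` is moved to `v` by `s`. -/
theorem inducedCocycle_mul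
    {c : ∀ p, MulAction.stabilizer (L ≃ₐ[K] L) (E.rep p) → localR ℓ (E.rep p)}
    (hc : ∀ p g h, c p (g * h) = decompositionRep ℓ (E.rep p) g (c p h) + c p g)
    (σ τ : L ≃ₐ[K] L) :
    E.inducedCocycle c (σ * τ) = productRep ℓ σ (E.inducedCocycle c τ) + E.inducedCocycle c σ := by
  funext v
  have hv := E.liesOver_below v
  set p := E.below v
  have hs := E.trans_smul hv
  have hu := E.trans_smul (hv.smul σ⁻¹)
  have hw := E.trans_smul ((hv.smul σ⁻¹).smul τ⁻¹)
  set s := E.trans v p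
  set t := E.trans (σ⁻¹ • v) p
  set r := E.trans (τ⁻¹ • σ⁻¹ • v) p
  have hg1 : s⁻¹ * σ * t ∈ MulAction.stabilizer (L ≃ₐ[K] L) (E.rep p) := by
    rw [MulAction.mem_stabilizer_iff, mul_smul, mul_smul, hu, smul_inv_smul, inv_smul_eq_iff, hs]
  have hg2 : t⁻¹ * τ * r ∈ MulAction.stabilizer (L ≃ₐ[K] L) (E.rep p) := by
    rw [MulAction.mem_stabilizer_iff, mul_smul, mul_smul, hw, smul_inv_smul, inv_smul_eq_iff, hu]
  rw [Pi.add_apply, E.inducedCocycle_eq c (σ * τ) v p hs (⟨_, hg1⟩ * ⟨_, hg2⟩) (by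
      rw [mul_inv_rev, mul_smul]
      change s⁻¹ * σ * t * (t⁻¹ * τ * r) = s⁻¹ * (σ * τ) * r
      group),
    hc, map_add, E.inducedCocycle_eq c σ v p hs ⟨_, hg1⟩ rfl, productRep_apply,
    E.inducedCocycle_eq c τ _ p hu ⟨_, hg2⟩ rfl]
  congr 1
  have h3 : (σ * t) • E.rep p = v := by rw [mul_smul, hu, smul_inv_smul]
  exact (galR_galR ℓ _ _ (σ * t) (by simp [mul_assoc]) _ _ _ hg1 hs h3 _).trans
    (galR_galR ℓ _ _ (σ * t) rfl _ _ _ hu (smul_inv_smul σ v) h3 _).symm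

/-- A cocycle vanishing on the decomposition groups at the chosen places is a coboundary of an
element whose components are components of values of the cocycle. -/
theorem exists_coboundary_of_vanishing {x : (L ≃ₐ[K] L) → ∀ v : Place L, localR ℓ v}
    (hx : ∀ g h, x (g * h) = productRep ℓ g (x h) + x g)
    (h0 : ∀ p (h : MulAction.stabilizer (L ≃ₐ[K] L) (E.rep p)), x h (E.rep p) = 0) :
    ∃ z : ∀ v : Place L, localR ℓ v, (∀ v, ∃ g, z v = -x g v) ∧
      ∀ g, productRep ℓ g z - z = x g := by
  let s : Place L → L ≃ₐ[K] L := fun v => E.trans v (E.below v)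
  have hs : ∀ v, s v • E.rep (E.below v) = v := fun v => E.trans_smul (E.liesOver_below v)
  -- Since `σ` and `s v` differ by an element of the decomposition group, where `x` vanishes at the
  -- chosen place, the component of `x σ` at `v` depends only on `v`.
  have key : ∀ v (σ : L ≃ₐ[K] L), σ • E.rep (E.below v) = v → x σ v = x (s v) v := by
    intro v σ h
    have hstab : (s v)⁻¹ * σ ∈ MulAction.stabilizer (L ≃ₐ[K] L) (E.rep (E.below v)) := by
      rw [MulAction.mem_stabilizer_iff, mul_smul, h, inv_smul_eq_iff, hs]
    rw [show σ = s v * ((s v)⁻¹ * σ) by simp, hx, Pi.add_apply,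
      productRep_apply_of_smul_eq _ _ _ _ (hs v), h0 _ ⟨_, hstab⟩, map_zero, zero_add]
  refine ⟨fun v => -x (s v) v, fun v => ⟨s v, rfl⟩, fun g => funext fun v => ?_⟩
  have hb : E.below (g⁻¹ • v) = E.below v := E.below_eq ((E.liesOver_below v).smul g⁻¹)
  have hu : x (s (g⁻¹ • v)) (g⁻¹ • v) = x (g⁻¹ * s v) (g⁻¹ • v) :=
    (key _ _ (by rw [hb, mul_smul, hs])).symm
  -- The cocycle relation for the factorization `s v = g * (g⁻¹ * s v)`, read at `v`, is the desired
  -- coboundary relation.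
  have h2 := congrFun (hx g (g⁻¹ * s v)) v
  rw [mul_inv_cancel_left, Pi.add_apply, productRep_apply] at h2
  rw [Pi.sub_apply, productRep_apply, hu, map_neg, h2]
  abel

/-! ### From vanishing for the local units to the cohomology of ideles. -/

section Transfer

variable {ι : Type} {j : ι → Place K} (hj : Function.Injective j)
  (J : Subrepresentation
    (productRep ℓ : Representation ℤ_[ℓ] (L ≃ₐ[K] L) (∀ v : Place L, localR ℓ v)))
  (hJ : ∀ x, x ∈ J.toSubmodule ↔ {v | x v ∉ localU ℓ v}.Finite ∧
    ∀ v, E.below v ∉ Set.range j → x v ∈ localU ℓ v)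
  (S : Finset (Place K)) (hS : ∀ p ∈ S, p ∈ Set.range j)

theorem finite_rep_notMem {x : ∀ v : Place L, localR ℓ v} (hx : {v | x v ∉ localU ℓ v}.Finite) :
    {p | x (E.rep p) ∉ localU ℓ (E.rep p)}.Finite :=
  hx.preimage (f := E.rep) E.rep_injective.injOn

theorem single_mem_localU {y : ∀ p, localR ℓ (E.rep p)} {v : Place L}
    (h : y (E.below v) ∈ localU ℓ (E.rep (E.below v))) : E.single y v ∈ localU ℓ v := by
  unfold single
  split_ifs
  · exact galR_mem_localU ℓ _ _ _ _ _ h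
  · exact Submodule.zero_mem _

include hJ in
theorem single_mem [FiniteDimensional K L] {y : ∀ p, localR ℓ (E.rep p)}
    (hy : {p | y p ∉ localU ℓ (E.rep p)}.Finite)
    (hyj : ∀ p ∉ Set.range j, y p ∈ localU ℓ (E.rep p)) : E.single y ∈ J.toSubmodule :=
  (hJ _).2 ⟨(E.finite_liesOver hy).subset fun _ hv hcon => hv (E.single_mem_localU hcon),
    fun _ hv => E.single_mem_localU (hyj _ hv)⟩

include hj hJ hS in
theorem exists_tateH_zero [FiniteDimensional K L]
    (hac : ∀ p ∉ S, ∀ x ∈ localU ℓ (E.rep p),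
      (∀ h, decompositionRep (K := K) ℓ (E.rep p) h x = x) →
      ∃ y ∈ localU ℓ (E.rep p), ∑ᶠ h, decompositionRep (K := K) ℓ (E.rep p) h y = x) :
    ∃ e : tateH (Rep.of J.toRepresentation) (0 : ℕ) ≃ₗ[ℤ_[ℓ]]
        DirectSum ι (fun i => tateH (localRep ℓ K (E.rep (j i))) (0 : ℕ)),
      ∀ i, IsRestriction (Rep.of J.toRepresentation) (localRep ℓ K (E.rep (j i)))
        (component J (E.rep (j i))) 0 (DirectSum.component ℤ_[ℓ] _ _ i ∘ₗ e.toLinearMap) := by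
  refine exists_tateH_zero_equiv (Rep.of J.toRepresentation) _ (fun i => localRep ℓ K (E.rep (j i)))
    (fun i => component J (E.rep (j i))) (fun i h m => component_ρ J _ h m) ?_ ?_ ?_ ?_
  · intro i m
    obtain ⟨m', hm'⟩ := exists_finsum_eq_finsum_subgroup (Rep.of J.toRepresentation).ρ
      (MulAction.stabilizer (L ≃ₐ[K] L) (E.rep (j i))) m
    refine ⟨component J _ m', ?_⟩
    rw [hm', map_finsum (component J (E.rep (j i))) (Set.toFinite _)]
    exact finsum_congr fun h => (component_ρ J _ h m').symm
  · intro x hx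
    refine ((S.finite_toSet.union (E.finite_rep_notMem ((hJ x.1).1 x.2).1)).preimage
      hj.injOn).subset fun i hi => ?_
    by_contra hcon
    simp only [Set.mem_preimage, Set.mem_union, not_or, Set.mem_ofPred_eq, not_not] at hcon
    obtain ⟨y, -, hy⟩ := hac (j i) hcon.1 _ hcon.2 fun h => by
      have := component_ρ J _ h x
      rw [hx] at this
      exact this.symm
    exact hi ⟨y, hy⟩
  · intro x hx hp
    have hxinv : ∀ g : L ≃ₐ[K] L, productRep ℓ g x.1 = x.1 := fun g => congrArg Subtype.val (hx g)
    -- The local preimage is taken in `U` whenever `p ∉ S` and `x` is a unit there, hence for almost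
    -- all `p`. Otherwise `p` is in the image of `j`, and the hypothesis on the local classes
    -- supplies some preimage.
    have hy : ∀ p, ∃ y, (∑ᶠ h, decompositionRep (K := K) ℓ (E.rep p) h y = x.1 (E.rep p)) ∧
        (p ∉ S → x.1 (E.rep p) ∈ localU ℓ (E.rep p) → y ∈ localU ℓ (E.rep p)) := by
      intro p
      by_cases hpS : p ∉ S ∧ x.1 (E.rep p) ∈ localU ℓ (E.rep p)
      · obtain ⟨y, hy1, hy2⟩ := hac p hpS.1 _ hpS.2 fun h => by
          have := component_ρ J _ h x
          rw [hx] at this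
          exact this.symm
        exact ⟨y, hy2, fun _ _ => hy1⟩
      · have hpj : p ∈ Set.range j := by
          by_contra hcon
          exact hpS ⟨fun h => hcon (hS p h), ((hJ x.1).1 x.2).2 _ (by rwa [below_rep])⟩
        obtain ⟨i, rfl⟩ := hpj
        obtain ⟨n, hn⟩ := hp i
        exact ⟨n, hn, fun h1 h2 => (hpS ⟨h1, h2⟩).elim⟩
    choose y hy1 hy2 using hy
    have hmem : E.single y ∈ J.toSubmodule := by
      refine E.single_mem J hJ ((S.finite_toSet.union
        (E.finite_rep_notMem ((hJ x.1).1 x.2).1)).subset fun p hp => ?_) fun p hp => ?_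
      · by_contra hcon
        simp only [Set.mem_union, not_or, Set.mem_ofPred_eq, not_not] at hcon
        exact hp (hy2 p hcon.1 hcon.2)
      · exact hy2 p (fun h => hp (hS p h)) (((hJ x.1).1 x.2).2 _ (by rwa [below_rep]))
    refine ⟨⟨E.single y, hmem⟩, Subtype.ext ?_⟩
    have hco : (∑ᶠ g, (Rep.of J.toRepresentation).ρ g ⟨E.single y, hmem⟩ :
        Rep.of J.toRepresentation).1 = ∑ᶠ g : L ≃ₐ[K] L, productRep ℓ g (E.single y) :=
      map_finsum J.toSubmodule.subtype (Set.toFinite _)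
    rw [hco]
    -- Both the norm of `single y` and `x` are invariant, so they need only be compared at the
    -- chosen places.
    refine E.ext_of_invariant (fun g => ?_) hxinv fun p => ?_
    · rw [map_finsum (productRep ℓ g) (Set.toFinite _)]
      conv_rhs => rw [← finsum_comp_equiv (Equiv.mulLeft g)]
      refine finsum_congr fun h => ?_
      rw [← Module.End.mul_apply, ← map_mul]
      rfl
    · rw [E.finsum_productRep_single_rep, hy1]
  · intro w hw hwf
    obtain ⟨w', hw1, hw2⟩ := exists_extension_of_injective
      (A := fun p => localR ℓ (E.rep p)) hj w
    have hinv : ∀ p h, decompositionRep (K := K) ℓ (E.rep p) h (w' p) = w' p := by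
      intro p h
      by_cases hp : p ∈ Set.range j
      · obtain ⟨i, rfl⟩ := hp
        rw [hw1]
        exact hw i h
      · rw [hw2 p hp, map_zero]
    have hmemU : ∀ v, w' (E.below v) = 0 → E.spread w' v ∈ localU ℓ v := fun v hv => by
      unfold spread
      rw [hv, map_zero]
      exact Submodule.zero_mem _
    have hmem : E.spread w' ∈ J.toSubmodule := by
      refine (hJ _).2 ⟨(E.finite_liesOver (hwf.image j)).subset fun v hv => ?_,
        fun v hv => hmemU v (hw2 _ hv)⟩
      by_contra hcon
      refine hv (hmemU v ?_)
      by_cases hp : E.below v ∈ Set.range j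
      · obtain ⟨i, hi⟩ := hp
        by_contra h0
        refine hcon ⟨i, fun hwi => h0 ?_, hi⟩
        rw [← hi, hw1]
        exact hwi
      · exact hw2 _ hp
    refine ⟨⟨E.spread w', hmem⟩, fun g => Subtype.ext (E.productRep_spread hinv g), fun i => ?_⟩
    exact (E.spread_rep hinv _).trans (hw1 i)

include hj hJ hS in
theorem exists_tateH_one [FiniteDimensional K L]
    (hac : ∀ p ∉ S, ∀ c : MulAction.stabilizer (L ≃ₐ[K] L) (E.rep p) → localR ℓ (E.rep p),
      (∀ h, c h ∈ localU ℓ (E.rep p)) →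
      (∀ g h, c (g * h) = decompositionRep (K := K) ℓ (E.rep p) g (c h) + c g) →
      ∃ y ∈ localU ℓ (E.rep p), ∀ h, decompositionRep (K := K) ℓ (E.rep p) h y - y = c h) :
    ∃ e : tateH (Rep.of J.toRepresentation) (1 : ℕ) ≃ₗ[ℤ_[ℓ]]
        DirectSum ι (fun i => tateH (localRep ℓ K (E.rep (j i))) (1 : ℕ)),
      ∀ i, IsRestriction (Rep.of J.toRepresentation) (localRep ℓ K (E.rep (j i)))
        (component J (E.rep (j i))) 1 (DirectSum.component ℤ_[ℓ] _ _ i ∘ₗ e.toLinearMap) := by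
  have hrest : ∀ x : (L ≃ₐ[K] L) → Rep.of J.toRepresentation,
      (∀ g h, x (g * h) = (Rep.of J.toRepresentation).ρ g (x h) + x g) → ∀ p,
      ∀ g h : MulAction.stabilizer (L ≃ₐ[K] L) (E.rep p), component J (E.rep p) (x ↑(g * h)) =
        decompositionRep ℓ (E.rep p) g (component J (E.rep p) (x h)) +
          component J (E.rep p) (x g) := fun x hx p g h => by
    rw [Subgroup.coe_mul, hx, map_add]
    exact congrArg (· + _) (component_ρ J _ g _)
  have hfinU : ∀ x : (L ≃ₐ[K] L) → Rep.of J.toRepresentation,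
      {v | ∃ g, (x g).1 v ∉ localU ℓ v}.Finite := fun x => by
    refine (Set.finite_iUnion fun g => ((hJ (x g).1).1 (x g).2).1).subset ?_
    rintro v ⟨g, hg⟩
    exact Set.mem_iUnion.2 ⟨g, hg⟩
  have hfinR : ∀ x : (L ≃ₐ[K] L) → Rep.of J.toRepresentation,
      {p | ∃ g, (x g).1 (E.rep p) ∉ localU ℓ (E.rep p)}.Finite := fun x =>
    (hfinU x).preimage (f := E.rep) E.rep_injective.injOn
  refine exists_tateH_one_equiv (Rep.of J.toRepresentation) _ (fun i => localRep ℓ K (E.rep (j i)))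
    (fun i => component J (E.rep (j i))) (fun i h m => component_ρ J _ h m) ?_ ?_ ?_
  · intro x hx
    refine ((S.finite_toSet.union (hfinR x)).preimage hj.injOn).subset fun i hi => ?_
    by_contra hcon
    simp only [Set.mem_preimage, Set.mem_union, not_or, Set.mem_ofPred_eq, not_exists,
      not_not] at hcon
    obtain ⟨y, -, hy⟩ := hac (j i) hcon.1 (fun h => component J _ (x h)) (fun h => hcon.2 h)
      (hrest x hx (j i))
    exact hi ⟨y, hy⟩
  · intro x hx hp
    have hy : ∀ p, ∃ y, (∀ h, decompositionRep (K := K) ℓ (E.rep p) h y - y =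
        component J (E.rep p) (x h)) ∧
        (p ∉ S → (∀ g, (x g).1 (E.rep p) ∈ localU ℓ (E.rep p)) → y ∈ localU ℓ (E.rep p)) := by
      intro p
      by_cases hpS : p ∉ S ∧ ∀ g, (x g).1 (E.rep p) ∈ localU ℓ (E.rep p)
      · obtain ⟨y, hy1, hy2⟩ := hac p hpS.1 (fun h => component J _ (x h)) (fun h => hpS.2 h)
          (hrest x hx p)
        exact ⟨y, hy2, fun _ _ => hy1⟩
      · have hpj : p ∈ Set.range j := by
          by_contra hcon
          exact hpS ⟨fun h => hcon (hS p h), fun g =>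
            ((hJ (x g).1).1 (x g).2).2 _ (by rwa [below_rep])⟩
        obtain ⟨i, rfl⟩ := hpj
        obtain ⟨n, hn⟩ := hp i
        exact ⟨n, hn, fun h1 h2 => (hpS ⟨h1, h2⟩).elim⟩
    choose y hy1 hy2 using hy
    have hmem : E.single y ∈ J.toSubmodule := by
      refine E.single_mem J hJ ((S.finite_toSet.union (hfinR x)).subset fun p hp => ?_)
        fun p hp => ?_
      · by_contra hcon
        simp only [Set.mem_union, not_or, Set.mem_ofPred_eq, not_exists, not_not] at hcon
        exact hp (hy2 p hcon.1 hcon.2)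
      · exact hy2 p (fun h => hp (hS p h)) fun g =>
          ((hJ (x g).1).1 (x g).2).2 _ (by rwa [below_rep])
    -- Subtracting the coboundary of `Y` makes the cocycle vanish on each decomposition group at its
    -- chosen place.
    let Y : Rep.of J.toRepresentation := ⟨E.single y, hmem⟩
    let x' : (L ≃ₐ[K] L) → Rep.of J.toRepresentation := fun g =>
      x g - ((Rep.of J.toRepresentation).ρ g Y - Y)
    obtain ⟨z, hz1, hz2⟩ := E.exists_coboundary_of_vanishing (x := fun g => (x' g).1)
      (fun g h => by
        have : x' (g * h) = (Rep.of J.toRepresentation).ρ g (x' h) + x' g := by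
          simp only [x', hx, map_mul, Module.End.mul_apply, map_sub]
          abel
        exact congrArg Subtype.val this)
      (fun p h => by
        have h1 : component J (E.rep p) (x' h) = 0 := by
          have hY : component J (E.rep p) Y = y p := E.single_rep y p
          have h2 := component_ρ J _ h Y
          rw [hY] at h2
          simp only [x', map_sub]
          rw [h2, hY, sub_eq_zero]
          exact (hy1 p h).symm
        exact h1)
    -- Each component of `z` is, up to sign, a component of one of the finitely many values of `x'`,
    -- so `z` inherits from them the conditions defining `J`.
    have hzmem : z ∈ J.toSubmodule := by
      refine (hJ z).2 ⟨(hfinU x').subset fun v hv => ?_, fun v hv => ?_⟩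
      · obtain ⟨g, hg⟩ := hz1 v
        exact ⟨g, fun hcon => hv (by rw [hg]; exact Submodule.neg_mem _ hcon)⟩
      · obtain ⟨g, hg⟩ := hz1 v
        rw [hg]
        exact Submodule.neg_mem _ (((hJ (x' g).1).1 (x' g).2).2 v hv)
    let Z : Rep.of J.toRepresentation := ⟨z, hzmem⟩
    refine ⟨Z + Y, fun g => ?_⟩
    have hZ : (Rep.of J.toRepresentation).ρ g Z - Z = x' g := Subtype.ext (hz2 g)
    rw [map_add, add_sub_add_comm, hZ]
    exact sub_add_cancel _ _
  · intro w hw hwf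
    obtain ⟨w', hw1, hw2⟩ := exists_extension_of_injective
      (A := fun p => MulAction.stabilizer (L ≃ₐ[K] L) (E.rep p) → localR ℓ (E.rep p)) hj w
    have hcoc : ∀ p g h, w' p (g * h) = decompositionRep (K := K) ℓ (E.rep p) g (w' p h) +
        w' p g := by
      intro p g h
      by_cases hp : p ∈ Set.range j
      · obtain ⟨i, rfl⟩ := hp
        rw [hw1]
        exact hw i g h
      · simp [hw2 p hp]
    have hmemU : ∀ τ v, w' (E.below v) = 0 → E.inducedCocycle w' τ v ∈ localU ℓ v :=
      fun τ v hv => by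
        unfold inducedCocycle
        rw [hv, Pi.zero_apply, map_zero]
        exact Submodule.zero_mem _
    have hmem : ∀ τ, E.inducedCocycle w' τ ∈ J.toSubmodule := by
      refine fun τ => (hJ _).2 ⟨(E.finite_liesOver (hwf.image j)).subset fun v hv => ?_,
        fun v hv => hmemU τ v (hw2 _ hv)⟩
      by_contra hcon
      refine hv (hmemU τ v ?_)
      by_cases hp : E.below v ∈ Set.range j
      · obtain ⟨i, hi⟩ := hp
        by_contra h0
        refine hcon ⟨i, fun hwi => h0 ?_, hi⟩
        rw [← hi, hw1]
        exact hwi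
      · exact hw2 _ hp
    refine ⟨fun τ => ⟨E.inducedCocycle w' τ, hmem τ⟩,
      fun g h => Subtype.ext (E.inducedCocycle_mul hcoc g h), fun i h => ?_⟩
    exact (E.inducedCocycle_rep w' _ h).trans (congrFun (hw1 i) h)

end Transfer

end PlaceSystem
end Induction
-- Group actions on fields: independence of characters and norms.
section FiniteField

variable {k G : Type*} [Field k] [Group G] [Fintype G] [MulSemiringAction G k] [FaithfulSMul G k]

/-- By faithfulness the elements of `G` are distinct characters of `k`, and distinct characters are
linearly independent. -/
theorem exists_sum_mul_smul_ne_zero (a : G → k) (ha : a 1 ≠ 0) : ∃ c, ∑ g, a g * g • c ≠ 0 := by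
  by_contra! hcon
  have hinj : Function.Injective fun g : G => MulDistribMulAction.toMonoidHom k g := fun g h e =>
    FaithfulSMul.eq_of_smul_eq_smul fun x => DFunLike.congr_fun e x
  have h := Fintype.linearIndependent_iff.1 ((linearIndependent_monoidHom k k).comp _ hinj) a
    (funext fun c => by simpa using hcon c) 1
  exact ha h

/-- The norm of an extension of finite fields is surjective, and by faithfulness `G` is the Galois
group of `k` over its fixed field. -/
theorem exists_prod_smul_eq [Finite k] (x : k) (hx : ∀ g : G, g • x = x) :
    ∃ y : k, ∏ g : G, g • y = x := by
  obtain ⟨y, hy⟩ := FiniteField.norm_surjective (FixedPoints.subfield G k) k ⟨x, hx⟩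
  refine ⟨y, ?_⟩
  have h := Algebra.norm_eq_prod_automorphisms (FixedPoints.subfield G k) y
  rw [hy, ← Equiv.prod_comp (FixedPoints.toAlgAutMulEquiv G k).toEquiv] at h
  exact h.symm

end FiniteField

/-! ### Divisibility in compact groups. -/

section CompactGroup

variable {A : Type*} [CommGroup A] [TopologicalSpace A] [IsTopologicalGroup A] [CompactSpace A]
  [T2Space A]

/-- The `ℓ`-th roots of `u` that are `ℓ^n`-th powers form a decreasing sequence of nonempty compact
sets. Their common point shows that the infinitely divisible elements form an `ℓ`-divisible group.
-/
theorem exists_root_of_infinitely_divisible (ℓ : ℕ) {u : A} (hu : ∀ n, ∃ w, w ^ ℓ ^ n = u) :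
    ∃ w, w ^ ℓ = u ∧ ∀ n, ∃ z, z ^ ℓ ^ n = w := by
  have hcl : ∀ n, IsClosed {w : A | w ^ ℓ = u ∧ ∃ z, z ^ ℓ ^ n = w} := fun n =>
    (isClosed_eq (continuous_pow ℓ) continuous_const).inter
      (isCompact_range (continuous_pow (ℓ ^ n))).isClosed
  obtain ⟨w, hw⟩ := IsCompact.nonempty_iInter_of_sequence_nonempty_isCompact_isClosed
    (fun n => {w : A | w ^ ℓ = u ∧ ∃ z, z ^ ℓ ^ n = w})
    (fun n w hw => ⟨hw.1, by
      obtain ⟨z, hz⟩ := hw.2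
      exact ⟨z ^ ℓ, by rw [← pow_mul, ← pow_succ', hz]⟩⟩)
    (fun n => by
      obtain ⟨z, hz⟩ := hu (n + 1)
      exact ⟨z ^ ℓ ^ n, by rw [← pow_mul, ← pow_succ, hz], z, rfl⟩)
    (hcl 0).isCompact hcl
  rw [Set.mem_iInter] at hw
  exact ⟨w, (hw 0).1, fun n => (hw n).2⟩

end CompactGroup

/-! ### Infinitely divisible units have no `ℓ`-torsion. -/

section LocalRing

open IsLocalRing

variable {O : Type*} [CommRing O] {π : O}

theorem dvd_geomSum_sub {ℓ : ℕ} {v : O} (hv : π ∣ v - 1) :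
    π ∣ ∑ i ∈ Finset.range ℓ, v ^ i - (ℓ : O) := by
  have : (ℓ : O) = ∑ i ∈ Finset.range ℓ, 1 := by simp
  rw [this, ← Finset.sum_sub_distrib]
  exact Finset.dvd_sum fun i _ => hv.trans (by simpa using sub_dvd_pow_sub_pow v 1 i)

/-- Each `ℓ`-th power gains a factor `π`: in `v^ℓ - 1 = (v - 1)(1 + ⋯ + v^(ℓ-1))` the second factor
is congruent to `ℓ`, hence to 0, modulo `π`. -/
theorem pow_dvd_pow_prime_pow_sub_one {ℓ : ℕ} (hℓ : π ∣ (ℓ : O)) {v : O} (hv : π ∣ v - 1) (n : ℕ) :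
    π ^ (n + 1) ∣ v ^ ℓ ^ n - 1 := by
  induction n with
  | zero => simpa using hv
  | succ n ih =>
    have h1 : π ∣ v ^ ℓ ^ n - 1 := (dvd_pow_self π n.succ_ne_zero).trans ih
    rw [pow_succ, pow_succ ℓ, pow_mul, ← mul_geom_sum]
    refine mul_dvd_mul ih ?_
    exact (dvd_sub_left hℓ).1 (dvd_geomSum_sub h1)

variable [IsLocalRing O] (hmax : maximalIdeal O = Ideal.span {π})

include hmax in
theorem residue_eq_zero_iff_dvd (x : O) : residue O x = 0 ↔ π ∣ x := by
  rw [residue_eq_zero_iff, hmax, Ideal.mem_span_singleton]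

include hmax in
theorem isUnit_iff_not_dvd (x : O) : IsUnit x ↔ ¬ π ∣ x := by
  rw [← residue_eq_zero_iff_dvd hmax, ← residue_ne_zero_iff_isUnit]

include hmax in
theorem eq_one_of_pow_prime_eq_one [Finite (ResidueField O)] {ℓ : ℕ} (hℓ : ℓ.Prime)
    (hsep : ∀ x : O, (∀ n, π ^ n ∣ x) → x = 0) {u : Oˣ} (hu : ∀ n, ∃ w, w ^ ℓ ^ n = u)
    (h1 : u ^ ℓ = 1) : u = 1 := by
  have hℓ' := Fact.mk hℓ
  by_cases hdvd : π ∣ (ℓ : O)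
  · have hcard : ∀ z : Oˣ, π ∣ ((z ^ Nat.card (ResidueField O)ˣ : Oˣ) : O) - 1 := by
      intro z
      rw [← residue_eq_zero_iff_dvd hmax, map_sub, map_one, sub_eq_zero]
      exact congrArg Units.val (pow_card_eq_one' (x := Units.map (residue O : O →* ResidueField O) z))
    have hcop : (Nat.card (ResidueField O)ˣ).Coprime ℓ := by
      have := Fintype.ofFinite (ResidueField O)
      have h0 : (ℓ : ResidueField O) = 0 := by
        rw [← map_natCast (residue O)]
        exact (residue_eq_zero_iff_dvd hmax _).2 hdvd
      have hchar : CharP (ResidueField O) ℓ := by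
        exact (CharP.charP_iff_prime_eq_zero hℓ).2 h0
      obtain ⟨n, hn, hc⟩ := FiniteField.card (ResidueField O) ℓ
      rw [Nat.card_units, Nat.card_eq_fintype_card, hc]
      rw [Nat.coprime_comm, Nat.Prime.coprime_iff_not_dvd hℓ]
      intro hd
      have h2 : ℓ ∣ ℓ ^ (n : ℕ) := dvd_pow_self _ n.ne_zero
      have h3 : 1 ≤ ℓ ^ (n : ℕ) := Nat.one_le_pow _ _ hℓ.pos
      have := (Nat.dvd_sub_iff_right h3 h2).1 hd
      exact hℓ.one_lt.ne' (Nat.dvd_one.1 this)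
    have hm : u ^ Nat.card (ResidueField O)ˣ = 1 := by
      refine Units.ext (sub_eq_zero.1 (hsep _ fun n => ?_))
      obtain ⟨w, rfl⟩ := hu n
      rw [← pow_mul, mul_comm, pow_mul]
      exact (pow_dvd_pow _ n.le_succ).trans (pow_dvd_pow_prime_pow_sub_one hdvd (hcard w) n)
    have := orderOf_dvd_of_pow_eq_one hm
    have := orderOf_dvd_of_pow_eq_one h1
    exact orderOf_eq_one_iff.1 (Nat.eq_one_of_dvd_coprimes hcop ‹_› ‹_›)
  -- Residue characteristic different from `ℓ`: divisibility kills the `ℓ`-part of the residue of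
  -- `u`, so `u` is congruent to 1. Then `1 + ⋯ + u^(ℓ-1)` is congruent to the unit `ℓ` and can be
  -- cancelled from `u^ℓ - 1 = 0`.
  · have hres : π ∣ (u : O) - 1 := by
      rw [← residue_eq_zero_iff_dvd hmax, map_sub, map_one, sub_eq_zero]
      let f := Units.map (residue O : O →* ResidueField O)
      obtain ⟨a, m, hm, hc⟩ := Nat.exists_eq_pow_mul_and_not_dvd
        (Nat.card_pos (α := (ResidueField O)ˣ)).ne' ℓ hℓ.ne_one
      obtain ⟨w, hw⟩ := hu a
      have h2 : f u ^ m = 1 := by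
        rw [← hw, map_pow, ← pow_mul, ← hc, pow_card_eq_one']
      have h3 : f u ^ ℓ = 1 := by rw [← map_pow, h1, map_one]
      have h4 : f u = 1 := orderOf_eq_one_iff.1 (Nat.eq_one_of_dvd_coprimes
        ((Nat.Prime.coprime_iff_not_dvd hℓ).2 hm) (orderOf_dvd_of_pow_eq_one h3)
        (orderOf_dvd_of_pow_eq_one h2))
      exact congrArg Units.val h4
    have hunit : IsUnit (∑ i ∈ Finset.range ℓ, (u : O) ^ i) := by
      rw [isUnit_iff_not_dvd hmax]
      intro hcon
      exact hdvd ((dvd_sub_right hcon).1 (dvd_geomSum_sub hres))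
    refine Units.ext (sub_eq_zero.1 ?_)
    rw [← hunit.mul_left_eq_zero, Units.val_one, mul_geom_sum, ← Units.val_pow_eq_pow_val, h1]
    simp

end LocalRing

/-! ### Units of a local ring under a group acting faithfully on the residue field. -/

section LocalRingAction

theorem exists_prod_one_add_mul {ι R : Type*} [CommRing R] (s : Finset ι) (t : R) (f : ι → R) :
    ∃ r, ∏ i ∈ s, (1 + t * f i) = 1 + t * ∑ i ∈ s, f i + t ^ 2 * r := by
  classical
  induction s using Finset.induction_on with
  | empty => exact ⟨0, by simp⟩
  | insert i s hi ih =>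
    obtain ⟨r, hr⟩ := ih
    refine ⟨f i * ∑ i ∈ s, f i + r + t * r * f i, ?_⟩
    rw [Finset.prod_insert hi, Finset.sum_insert hi, hr]
    ring

open IsLocalRing

variable {O G : Type*} [CommRing O] [IsLocalRing O] [Group G] [MulSemiringAction G O]
  {π : O} (hmax : maximalIdeal O = Ideal.span {π})
  (hfaith : ∀ g : G, g ≠ 1 → ∃ x : O, ¬ π ∣ g • x - x)

include hmax hfaith in
-- The hypothesis `hfaith` says that the inertia group is trivial.
theorem faithfulSMul_residueField : FaithfulSMul G (ResidueField O) := by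
  refine ⟨fun {g h} e => ?_⟩
  by_contra hne
  obtain ⟨x, hx⟩ := hfaith (h⁻¹ * g) (fun h1 => hne (inv_mul_eq_one.1 h1).symm)
  apply hx
  rw [← residue_eq_zero_iff_dvd hmax, map_sub, sub_eq_zero, ResidueField.residue_smul, mul_smul, e,
    inv_smul_smul]

variable [Fintype G]

include hmax hfaith in
theorem exists_isUnit_sum_mul_smul (a : G → Oˣ) : ∃ c : O, IsUnit (∑ g, a g * g • c) := by
  have := faithfulSMul_residueField hmax hfaith
  obtain ⟨c, hc⟩ := exists_sum_mul_smul_ne_zero (fun g => residue O (a g))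
    ((residue_ne_zero_iff_isUnit _).2 (a 1).isUnit)
  obtain ⟨c, rfl⟩ := residue_surjective c
  refine ⟨c, (residue_ne_zero_iff_isUnit _).1 ?_⟩
  simpa [ResidueField.residue_smul] using hc

include hmax hfaith in
-- Hilbert 90 with integral control: the resolvent `b = ∑ f(h) h(c)` satisfies `f(g) g(b) = b`, and
-- `c` can be chosen so that `b` is a unit. Its inverse is the witness.
theorem exists_unit_coboundary (f : G → Oˣ) (hf : ∀ g h, (f (g * h) : O) = g • (f h : O) * f g) :
    ∃ w : Oˣ, ∀ g, (f g : O) * w = g • (w : O) := by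
  obtain ⟨c, hc⟩ := exists_isUnit_sum_mul_smul hmax hfaith f
  obtain ⟨b, hb⟩ := hc
  have key : ∀ g, (f g : O) * g • (b : O) = b := by
    intro g
    rw [hb, Finset.smul_sum, Finset.mul_sum,
      ← Equiv.sum_comp (Equiv.mulLeft g) (fun h => (f h : O) * h • c)]
    refine Finset.sum_congr rfl fun h _ => ?_
    rw [smul_mul', Equiv.coe_mulLeft, hf, mul_smul]
    ring
  refine ⟨b⁻¹, fun g => ?_⟩
  have h1 : g • ((b⁻¹ : Oˣ) : O) * g • (b : O) = 1 := by rw [← smul_mul', Units.inv_mul, smul_one]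
  calc (f g : O) * (b⁻¹ : Oˣ) = (f g * (b⁻¹ : Oˣ)) * (g • ((b⁻¹ : Oˣ) : O) * g • (b : O)) := by
        rw [h1, mul_one]
    _ = (f g * g • (b : O)) * (b⁻¹ : Oˣ) * g • ((b⁻¹ : Oˣ) : O) := by ring
    _ = _ := by rw [key, Units.mul_inv, one_mul]

include hmax hfaith in
-- Some trace is a unit `t`; as `t` is invariant, dividing by it gives an element of trace 1.
theorem exists_sum_smul_eq_one : ∃ c : O, ∑ g : G, g • c = 1 := by
  obtain ⟨c, hc⟩ := exists_isUnit_sum_mul_smul hmax hfaith 1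
  simp only [Pi.one_apply, Units.val_one, one_mul] at hc
  obtain ⟨t, ht⟩ := hc
  have hfix : ∀ g : G, g • (t : O) = t := fun g => by
    rw [ht, Finset.smul_sum, ← Equiv.sum_comp (Equiv.mulLeft g) (fun h => h • c)]
    simp [mul_smul]
  have hfix' : ∀ g : G, g • ((t⁻¹ : Oˣ) : O) = (t⁻¹ : Oˣ) := fun g => by
    have h1 : g • ((t⁻¹ : Oˣ) : O) * (t : O) = 1 := by
      conv_lhs => rw [← hfix g]
      rw [← smul_mul', Units.inv_mul, smul_one]
    rw [← mul_one (g • _), ← Units.mul_inv t, ← mul_assoc, h1, one_mul]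
  refine ⟨(t⁻¹ : Oˣ) * c, ?_⟩
  simp only [smul_mul', hfix']
  rw [← Finset.mul_sum, ← ht, Units.inv_mul]

variable [IsDomain O] [Finite (ResidueField O)] (hπ0 : π ≠ 0) (hπ : ∀ g : G, g • π = π)

include hmax hfaith hπ0 hπ in
theorem exists_pow_dvd_sub_prod_smul (x : Oˣ) (hx : ∀ g : G, g • (x : O) = x) (n : ℕ) :
    ∃ y : Oˣ, π ^ n ∣ (x : O) - ∏ g : G, g • (y : O) := by
  have := faithfulSMul_residueField hmax hfaith
  -- Exponent 0 imposes no condition. The induction starts at exponent 1, with the norm of the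
  -- residue field, because the correction factor is a unit only for a positive power of `π`.
  rcases n with - | n
  · exact ⟨1, by simp⟩
  induction n with
  | zero =>
    obtain ⟨y, hy⟩ := exists_prod_smul_eq (G := G) (residue O x) fun g => by
      rw [← ResidueField.residue_smul, hx]
    obtain ⟨y, rfl⟩ := residue_surjective y
    have hyu : IsUnit y := by
      rw [← residue_ne_zero_iff_isUnit]
      intro h0
      rw [h0] at hy
      simp only [smul_zero, Finset.prod_const] at hy
      rw [zero_pow (by simp [Finset.card_univ, Fintype.card_ne_zero])] at hy
      exact (residue_ne_zero_iff_isUnit _).2 x.isUnit hy.symm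
    obtain ⟨y, rfl⟩ := hyu
    refine ⟨y, ?_⟩
    rw [zero_add, pow_one, ← residue_eq_zero_iff_dvd hmax, map_sub, map_prod, ← hy]
    simp [ResidueField.residue_smul]
  | succ n ih =>
    obtain ⟨y, a, ha⟩ := ih
    obtain ⟨c, hc⟩ := exists_sum_smul_eq_one hmax hfaith
    set N : Oˣ := ∏ g : G, Units.map (MulDistribMulAction.toMonoidHom O g) y with hN
    have hNy : ∏ g : G, g • (y : O) = N := by simp [hN, Units.coe_prod]
    have hNfix : ∀ g : G, g • (N : O) = N := fun g => by
      rw [← hNy, Finset.smul_prod', ← Equiv.prod_comp (Equiv.mulLeft g) (fun h => h • (y : O))]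
      simp [mul_smul]
    have hNfix' : ∀ g : G, g • ((N⁻¹ : Oˣ) : O) = (N⁻¹ : Oˣ) := fun g => by
      have h1 : g • ((N⁻¹ : Oˣ) : O) * (N : O) = 1 := by
        conv_lhs => rw [← hNfix g]
        rw [← smul_mul', Units.inv_mul, smul_one]
      rw [← mul_one (g • _), ← Units.mul_inv N, ← mul_assoc, h1, one_mul]
    have hafix : ∀ g : G, g • a = a := fun g => by
      have h2 : π ^ (n + 1) * g • a = π ^ (n + 1) * a := by
        rw [← ha, hNy]
        conv_rhs => rw [← hx g, ← hNfix g, ← smul_sub, ← hNy, ha, smul_mul', smul_pow', hπ]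
      exact mul_left_cancel₀ (pow_ne_zero _ hπ0) h2
    -- With `c` of trace 1 and `a`, `N` invariant, `b` has trace `a / N`. Hence the norm of `1 +
    -- π^(n+1) b` cancels the error `π^(n+1) a` up to terms divisible by `(π^(n+1))^2`.
    set b := c * a * (N⁻¹ : Oˣ)
    have hb : ∑ g : G, g • b = a * (N⁻¹ : Oˣ) := by
      simp only [b, smul_mul', hNfix', hafix]
      rw [← Finset.sum_mul, ← Finset.sum_mul, hc, one_mul]
    have hu : IsUnit (1 + π ^ (n + 1) * b) := by
      rw [isUnit_iff_not_dvd hmax]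
      intro hcon
      have h3 : π ∣ π ^ (n + 1) * b := (dvd_pow_self π n.succ_ne_zero).mul_right _
      have h4 : π ∣ 1 := (dvd_add_left h3).1 hcon
      exact (isUnit_iff_not_dvd hmax 1).1 isUnit_one h4
    obtain ⟨v, hv⟩ := hu
    obtain ⟨r, hr⟩ := exists_prod_one_add_mul Finset.univ (π ^ (n + 1)) fun g : G => g • b
    refine ⟨y * v, ?_⟩
    have h5 : ∏ g : G, g • ((y * v : Oˣ) : O) =
        N * (1 + π ^ (n + 1) * (a * (N⁻¹ : Oˣ)) + (π ^ (n + 1)) ^ 2 * r) := by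
      rw [← hb, ← hr, ← hNy, ← Finset.prod_mul_distrib]
      refine Finset.prod_congr rfl fun g _ => ?_
      rw [Units.val_mul, hv, smul_mul', smul_add, smul_mul', smul_pow', hπ, smul_one]
    have h6 : (x : O) - ∏ g : G, g • ((y * v : Oˣ) : O) = -((N : O) * r * (π ^ (n + 1)) ^ 2) := by
      have h7 : (N : O) * (N⁻¹ : Oˣ) = 1 := Units.mul_inv N
      rw [hNy] at ha
      rw [h5]
      linear_combination ha - π ^ (n + 1) * a * h7
    rw [h6, dvd_neg, ← pow_mul]
    exact (pow_dvd_pow _ (by omega)).mul_left _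

variable [TopologicalSpace O] [IsTopologicalRing O] [CompactSpace O] [T2Space O]
  [ContinuousConstSMul G O] (hsep : ∀ x : O, (∀ n, π ^ n ∣ x) → x = 0)

include hmax hfaith hπ0 hπ hsep in
-- The solutions modulo `π^n` form a decreasing sequence of nonempty closed subsets of the compact
-- unit group; a common point solves the equation exactly.
theorem exists_prod_smul_eq_unit (x : Oˣ) (hx : ∀ g : G, g • (x : O) = x) :
    ∃ y : Oˣ, ∏ g : G, g • (y : O) = x := by
  have hcl : ∀ n, IsClosed {y : Oˣ | π ^ n ∣ (x : O) - ∏ g : G, g • (y : O)} := by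
    intro n
    have h1 : IsClosed {z : O | π ^ n ∣ z} := by
      have : {z : O | π ^ n ∣ z} = Set.range fun t => π ^ n * t := by
        ext z
        exact ⟨fun ⟨t, ht⟩ => ⟨t, ht.symm⟩, fun ⟨t, ht⟩ => ⟨t, ht.symm⟩⟩
      rw [this]
      exact (isCompact_range (continuous_const.mul continuous_id)).isClosed
    refine h1.preimage (f := fun y : Oˣ => (x : O) - ∏ g : G, g • (y : O)) ?_
    exact continuous_const.sub (continuous_finsetProd _ fun g _ =>
      Units.continuous_val.const_smul g)
  obtain ⟨y, hy⟩ := IsCompact.nonempty_iInter_of_sequence_nonempty_isCompact_isClosed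
    (fun n => {y : Oˣ | π ^ n ∣ (x : O) - ∏ g : G, g • (y : O)})
    (fun n y hy => (pow_dvd_pow _ n.le_succ).trans hy)
    (fun n => exists_pow_dvd_sub_prod_smul hmax hfaith hπ0 hπ x hx n) (hcl 0).isCompact hcl
  rw [Set.mem_iInter] at hy
  exact ⟨y, (sub_eq_zero.1 (hsep _ hy)).symm⟩

end LocalRingAction

/-! ### Descent of vanishing along a uniquely `ℓ`-divisible kernel. -/

section UniquelyDivisibleKernel

theorem exists_unit_natCast_of_not_dvd {ℓ : ℕ} [Fact ℓ.Prime] {m : ℕ} (hm : ¬ ℓ ∣ m) :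
    ∃ c : ℤ_[ℓ], c * m = 1 := by
  have h : IsUnit (m : ℤ_[ℓ]) := by
    rw [PadicInt.isUnit_iff]
    refine le_antisymm (PadicInt.norm_le_one _) (not_lt.1 fun h => hm ?_)
    have := (PadicInt.norm_int_lt_one_iff_dvd (p := ℓ) (m : ℤ)).1 (by simpa using h)
    exact_mod_cast this
  obtain ⟨u, hu⟩ := h
  exact ⟨(u⁻¹ : ℤ_[ℓ]ˣ), by rw [← hu, Units.inv_mul]⟩

theorem exists_pow_nsmul_eq_of_ker {ℓ : ℕ} {A B : Type*} [AddCommGroup A] [AddCommGroup B]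
    (φ : A →+ B) (hdiv : ∀ d, φ d = 0 → ∃ d', φ d' = 0 ∧ ℓ • d' = d) (s : ℕ) (d : A) (hd : φ d = 0) :
    ∃ d', φ d' = 0 ∧ ℓ ^ s • d' = d := by
  induction s generalizing d with
  | zero => exact ⟨d, hd, by simp⟩
  | succ s ih =>
    obtain ⟨d₁, h1, rfl⟩ := hdiv d hd
    obtain ⟨d₂, h2, rfl⟩ := ih d₁ h1
    exact ⟨d₂, h2, by rw [pow_succ', mul_smul]⟩

theorem eq_zero_of_pow_nsmul_eq_zero {ℓ : ℕ} {A B : Type*} [AddCommGroup A] [AddCommGroup B]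
    (φ : A →+ B) (htor : ∀ d, φ d = 0 → ℓ • d = 0 → d = 0) (s : ℕ) (d : A) (hd : φ d = 0)
    (h : ℓ ^ s • d = 0) :
    d = 0 := by
  induction s with
  | zero => simpa using h
  | succ s ih =>
    refine ih (htor _ (by rw [map_nsmul, hd, smul_zero]) ?_)
    rwa [← mul_smul, ← pow_succ']

variable {ℓ : ℕ} [Fact ℓ.Prime] {G A B : Type*} [Group G] [Finite G] [AddCommGroup A]
  [AddCommGroup B] [Module ℤ_[ℓ] B] (α : G →* AddMonoid.End A) (β : Representation ℤ_[ℓ] G B)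
  (φ : A →+ B) (hφ : ∀ g a, φ (α g a) = β g (φ a)) (U : Submodule ℤ_[ℓ] B)
  (hU : ∀ b, b ∈ U ↔ ∃ a, φ a = b)
  (hdiv : ∀ d, φ d = 0 → ∃ d', φ d' = 0 ∧ ℓ • d' = d)
  (htor : ∀ d, φ d = 0 → ℓ • d = 0 → d = 0)

include hφ hU hdiv htor in
/-- If the norm map onto the invariants of `A` is surjective and the kernel of `A → B` is uniquely
`ℓ`-divisible, then the norm map onto the invariants of the image is surjective. -/
theorem exists_norm_eq_of_ker (hA : ∀ a, (∀ g, α g a = a) → ∃ w, ∑ᶠ g, α g w = a)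
    (b : B) (hb : b ∈ U) (hinv : ∀ g, β g b = b) : ∃ y ∈ U, ∑ᶠ g, β g y = b := by
  have := Fintype.ofFinite G
  simp only [finsum_eq_sum_of_fintype] at hA ⊢
  obtain ⟨a, rfl⟩ := (hU b).1 hb
  obtain ⟨s, m, hm, hc⟩ := Nat.exists_eq_pow_mul_and_not_dvd (Fintype.card_ne_zero (α := G)) ℓ
    (Fact.out : ℓ.Prime).ne_one
  have he : ∀ g, φ (α g a - a) = 0 := fun g => by rw [map_sub, hφ, hinv, sub_self]
  -- The lift `a` is invariant only modulo the kernel. Averaging its defect, with just the `ℓ`-part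
  -- `ℓ^s` of the order divided out, gives `ℓ^s (m a + z) = ∑ g a`; so `m a + z` is invariant, the
  -- kernel having no `ℓ`-torsion.
  obtain ⟨z, hz, hz'⟩ := exists_pow_nsmul_eq_of_ker φ hdiv s (∑ g, (α g a - a)) (by
    rw [map_sum]; exact Finset.sum_eq_zero fun g _ => he g)
  have hN : ∀ g, α g (∑ h, α h a) = ∑ h, α h a := fun g => by
    rw [map_sum, ← Equiv.sum_comp (Equiv.mulLeft g) fun h => α h a]
    simp
  rw [Finset.sum_sub_distrib, Finset.sum_const, Finset.card_univ, hc] at hz'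
  have hzg : ∀ g, z - α g z = m • (α g a - a) := by
    intro g
    rw [← sub_eq_zero]
    refine eq_zero_of_pow_nsmul_eq_zero φ htor s _ ?_ ?_
    · rw [map_sub, map_sub, hφ, hz, map_zero, map_nsmul, he]
      simp
    · rw [smul_sub, smul_sub, ← map_nsmul, hz', map_sub, hN, map_nsmul, ← mul_smul, smul_sub]
      abel
  obtain ⟨w, hw⟩ := hA (m • a + z) fun g => by
    rw [map_add, map_nsmul, ← sub_eq_zero]
    have := hzg g
    rw [smul_sub, sub_eq_sub_iff_add_eq_add] at this
    rw [sub_eq_zero, ← this, add_comm]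
  -- The norm equation holds for `m b`, and `m` is invertible in `ℤ_ℓ`.
  obtain ⟨c, hcm⟩ := exists_unit_natCast_of_not_dvd hm
  refine ⟨c • φ w, Submodule.smul_mem _ _ ((hU _).2 ⟨w, rfl⟩), ?_⟩
  simp only [map_smul, ← hφ]
  rw [← Finset.smul_sum, ← map_sum, hw, map_add, hz, add_zero, map_nsmul,
    ← Nat.cast_smul_eq_nsmul ℤ_[ℓ], ← mul_smul, hcm, one_smul]

include hφ hU hdiv htor in
/-- If every `1`-cocycle in `A` is a coboundary and the kernel of `A → B` is uniquely
`ℓ`-divisible, then every `1`-cocycle in the image is a coboundary. -/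
theorem exists_coboundary_of_ker
    (hA : ∀ f : G → A, (∀ g h, f (g * h) = α g (f h) + f g) → ∃ w, ∀ g, α g w - w = f g)
    (c : G → B) (hcU : ∀ g, c g ∈ U) (hc : ∀ g h, c (g * h) = β g (c h) + c g) :
    ∃ y ∈ U, ∀ g, β g y - y = c g := by
  have := Fintype.ofFinite G
  choose F hF using fun g => (hU _).1 (hcU g)
  obtain ⟨s, m, hm, hcard⟩ := Nat.exists_eq_pow_mul_and_not_dvd (Fintype.card_ne_zero (α := G)) ℓ
    (Fact.out : ℓ.Prime).ne_one
  have hcob : ∀ g h, φ (α g (F h) + F g - F (g * h)) = 0 := fun g h => by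
    rw [map_sub, map_add, hφ, hF, hF, hF, hc, sub_self]
  have hsum : ∀ g, ∑ h, (α g (F h) + F g - F (g * h)) =
      α g (∑ h, F h) - ∑ h, F h + (ℓ ^ s * m) • F g := fun g => by
    have hs : ∑ h, F (g * h) = ∑ h, F h := Equiv.sum_comp (Equiv.mulLeft g) F
    rw [Finset.sum_sub_distrib, Finset.sum_add_distrib, Finset.sum_const, Finset.card_univ, hcard,
      map_sum, hs]
    abel
  -- The lift `F` of `c` fails to be a cocycle by a 2-cocycle in the kernel. Summing this over `h`
  -- and dividing by `ℓ^s` gives `d` for which `ℓ^s (m F - d)` is a coboundary, so that `m F - d` is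
  -- a cocycle lifting `m c`.
  choose d hd hd' using fun g => exists_pow_nsmul_eq_of_ker φ hdiv s
    (∑ h, (α g (F h) + F g - F (g * h))) (by
      rw [map_sum]; exact Finset.sum_eq_zero fun h _ => hcob g h)
  have hF' : ∀ g, ℓ ^ s • (m • F g - d g) = ∑ h, F h - α g (∑ h, F h) := fun g => by
    rw [smul_sub, hd', hsum, mul_smul]
    abel
  have hφF : ∀ g, φ (m • F g - d g) = m • c g := fun g => by
    rw [map_sub, hd, sub_zero, map_nsmul, hF]
  obtain ⟨w, hw⟩ := hA (fun g => m • F g - d g) fun g h => by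
    rw [← sub_eq_zero]
    refine eq_zero_of_pow_nsmul_eq_zero φ htor s _ ?_ ?_
    · rw [map_sub, map_add, hφ, hφF, hφF, hφF, hc, map_nsmul, smul_add, sub_self]
    · rw [smul_sub, smul_add, ← map_nsmul, hF', hF', hF', map_sub,
        show α (g * h) (∑ h, F h) = α g (α h (∑ h, F h)) by rw [map_mul]; rfl]
      abel
  obtain ⟨t, ht⟩ := exists_unit_natCast_of_not_dvd hm
  refine ⟨t • φ w, Submodule.smul_mem _ _ ((hU _).2 ⟨w, rfl⟩), fun g => ?_⟩
  rw [map_smul, ← smul_sub, ← hφ, ← map_sub, hw, hφF, ← Nat.cast_smul_eq_nsmul ℤ_[ℓ], ← mul_smul,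
    ht, one_smul]

end UniquelyDivisibleKernel

/-! ### The canonical map to the `ℓ`-adification. -/

section LAdicOf

theorem mem_span_pow_smul_top_iff (ℓ : ℕ) {A : Type*} [CommGroup A] (n : ℕ) (a : A) :
    Additive.ofMul a ∈ (Ideal.span {(ℓ : ℤ)} ^ n • ⊤ : Submodule ℤ (Additive A)) ↔
      ∃ b, b ^ ℓ ^ n = a := by
  rw [Ideal.span_singleton_pow, Submodule.ideal_span_singleton_smul,
    Submodule.mem_smul_pointwise_iff_exists]
  have key : ∀ b : Additive A, ((ℓ : ℤ) ^ n) • b = (ℓ ^ n) • b := fun b => by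
    rw [← natCast_zsmul, Nat.cast_pow]
  constructor
  · rintro ⟨b, -, hb⟩
    rw [key] at hb
    exact ⟨b.toMul, hb⟩
  · rintro ⟨b, hb⟩
    refine ⟨Additive.ofMul b, trivial, ?_⟩
    rw [key]
    exact hb

variable (ℓ : ℕ) {A B : Type*} [CommGroup A] [CommGroup B]

/-- The canonical map from a group to its `ℓ`-adification. -/
noncomputable def LAdic.of : Additive A →+ LAdic ℓ A :=
  (AdicCompletion.of (Ideal.span {(ℓ : ℤ)}) (Additive A)).toAddMonoidHom

theorem LAdic.map_of [Fact ℓ.Prime] (f : A →* B) (a : A) :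
    LAdic.map ℓ f (LAdic.of ℓ (Additive.ofMul a)) = LAdic.of ℓ (Additive.ofMul (f a)) :=
  AdicCompletion.map_of _ _ _

theorem LAdic.of_eq_zero_iff (a : A) :
    LAdic.of ℓ (Additive.ofMul a) = 0 ↔ ∀ n, ∃ b, b ^ ℓ ^ n = a := by
  simp_rw [← mem_span_pow_smul_top_iff]
  constructor
  · intro h n
    have := congrArg (fun x : AdicCompletion (Ideal.span {(ℓ : ℤ)}) (Additive A) => x.1 n) h
    exact (Submodule.Quotient.mk_eq_zero _).1 this
  · intro h
    exact AdicCompletion.ext fun n => (Submodule.Quotient.mk_eq_zero _).2 (h n)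

/-- A compatible sequence of classes is a decreasing sequence of cosets of the groups of `ℓ^n`-th
powers. These are closed by compactness, so they have a common element. -/
theorem LAdic.of_surjective [TopologicalSpace A] [IsTopologicalGroup A] [CompactSpace A]
    [T2Space A] : Function.Surjective (LAdic.of ℓ (A := A)) := by
  intro x
  obtain ⟨f, rfl⟩ := AdicCompletion.mk_surjective _ _ x
  let t : ℕ → Set A := fun n => {a | ∃ b, b ^ ℓ ^ n = a / (f n).toMul}
  have hcl : ∀ n, IsClosed (t n) := fun n =>
    ((isCompact_range (continuous_pow (ℓ ^ n))).isClosed).preimage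
      (f := fun a : A => a / (f n).toMul) (continuous_id.div' continuous_const)
  obtain ⟨a, ha⟩ := IsCompact.nonempty_iInter_of_sequence_nonempty_isCompact_isClosed t
    (fun n a ha => by
      obtain ⟨b, hb⟩ := ha
      have h1 := (AdicCompletion.isAdicCauchy_iff _ _ _).1 f.2 n
      rw [SModEq.sub_mem] at h1
      obtain ⟨c, hc⟩ := (mem_span_pow_smul_top_iff ℓ n ((f n).toMul / (f (n + 1)).toMul)).1 h1
      refine ⟨b ^ ℓ * c⁻¹, ?_⟩
      rw [mul_pow, ← pow_mul, ← pow_succ', inv_pow, hb, hc]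
      simp)
    (fun n => ⟨(f n).toMul, 1, by simp⟩) (hcl 0).isCompact hcl
  rw [Set.mem_iInter] at ha
  refine ⟨Additive.ofMul a, AdicCompletion.ext fun n => ?_⟩
  exact (Submodule.Quotient.eq _).2
    ((mem_span_pow_smul_top_iff ℓ n (a / (f n).toMul)).2 (ha n))

end LAdicOf

/-! ### Places above a place of `K` form one Galois orbit. -/

section Orbits

variable {K L : Type} [Field K] [NumberField K] [Field L] [NumberField L] [Algebra K L]

theorem exists_liesOver (v : Place L) : ∃ p : Place K, v.LiesOver p := by
  match v with
  | .finite P =>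
    refine ⟨.finite ⟨P.asIdeal.under (𝓞 K), inferInstance, ?_⟩, ?_⟩
    · exact mt Ideal.eq_bot_of_comap_eq_bot P.ne_bot
    · exact ⟨rfl⟩
  | .infinite w => exact ⟨.infinite (w.comap (algebraMap K L)), ⟨rfl⟩⟩

theorem Place.LiesOver.unique {v : Place L} {p q : Place K} (hp : v.LiesOver p) (hq : v.LiesOver q) :
    p = q := by
  match v, p, q, hp, hq with
  | .finite P, .finite p, .finite q, hp, hq =>
    exact congrArg Place.finite (HeightOneSpectrum.ext (hp.over.trans hq.over.symm))
  | .infinite w, .infinite v, .infinite u, hp, hq =>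
    exact congrArg Place.infinite (Subtype.ext (hp.comp_eq.symm.trans hq.comp_eq))

theorem exists_smul_eq_of_liesOver [IsGalois K L] {u v : Place L} {p : Place K}
    (hu : u.LiesOver p) (hv : v.LiesOver p) : ∃ σ : L ≃ₐ[K] L, σ • u = v := by
  match u, v, p, hu, hv with
  | .finite P, .finite Q, .finite p, hu, hv =>
    have : P.asIdeal.LiesOver p.asIdeal := hu
    have : Q.asIdeal.LiesOver p.asIdeal := hv
    obtain ⟨σ, hσ⟩ := Ideal.exists_smul_eq_of_isGaloisGroup p.asIdeal P.asIdeal Q.asIdeal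
      (L ≃ₐ[K] L)
    refine ⟨σ, congrArg Place.finite (HeightOneSpectrum.ext (Eq.trans ?_ hσ))⟩
    refine Ideal.ext fun x => ?_
    rw [Ideal.mem_pointwise_smul_iff_inv_smul_mem]
    rfl
  | .infinite w, .infinite w', .infinite v, hu, hv =>
    obtain ⟨σ, hσ⟩ := InfinitePlace.exists_smul_eq_of_comap_eq (k := K) (w := w) (w' := w')
      (Subtype.ext (hu.comp_eq.trans hv.comp_eq.symm))
    exact ⟨σ, congrArg Place.infinite hσ⟩

open Classical in
/-- A choice of places above the places of `K` extends to a place system. -/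
noncomputable def PlaceSystem.ofRep [IsGalois K L] (P : Place K → Place L)
    (hP : ∀ p, (P p).LiesOver p) : PlaceSystem K L where
  rep := P
  liesOver_rep := hP
  below v := (exists_liesOver v).choose
  liesOver_below v := (exists_liesOver v).choose_spec
  below_eq {v _} h := Place.LiesOver.unique (exists_liesOver v).choose_spec h
  trans v p := if h : v = P p then 1 else
    if h : v.LiesOver p then (exists_smul_eq_of_liesOver (hP p) h).choose else 1
  trans_smul {v p} h := by
    by_cases hv : v = P p
    · rw [dif_pos hv, one_smul, hv]
    · rw [dif_neg hv, dif_pos h]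
      exact (exists_smul_eq_of_liesOver (hP p) h).choose_spec
  trans_rep p := dif_pos rfl

end Orbits

/-! ### The valuation ring of a completion: residue field, compactness, uniformizers. -/

section Completion

open IsLocalRing WithZero

variable {L : Type} [Field L] [NumberField L] {P : HeightOneSpectrum (𝓞 L)}

theorem mem_maximalIdeal_iff_valued_lt_one {x : P.adicCompletionIntegers L} :
    x ∈ maximalIdeal (P.adicCompletionIntegers L) ↔ Valued.v (x : P.adicCompletion L) < 1 := by
  rw [mem_maximalIdeal, mem_nonunits_iff,
    HeightOneSpectrum.adicCompletionIntegers.isUnit_iff_valued_eq_one, lt_iff_le_and_ne]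
  exact (and_iff_right x.2).symm

theorem valued_algebraMap (r : 𝓞 L) :
    Valued.v (algebraMap (𝓞 L) (P.adicCompletionIntegers L) r : P.adicCompletion L) =
      P.intValuation r :=
  (HeightOneSpectrum.valuedAdicCompletion_eq_valuation P r).trans
    (HeightOneSpectrum.valuation_of_algebraMap P r)

theorem algebraMap_mem_maximalIdeal_iff (r : 𝓞 L) :
    algebraMap (𝓞 L) (P.adicCompletionIntegers L) r ∈ maximalIdeal (P.adicCompletionIntegers L) ↔
      r ∈ P.asIdeal := by
  rw [mem_maximalIdeal_iff_valued_lt_one, valued_algebraMap,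
    HeightOneSpectrum.intValuation_lt_one_iff_mem]

/-- Elements of `L` are dense in the completion, and a `P`-integral element of `L` is congruent
modulo `P` to an algebraic integer. This bounds the residue field by a finite quotient of `𝓞 L`. -/
theorem residue_algebraMap_surjective : Function.Surjective
    ((residue (P.adicCompletionIntegers L)).comp
      (algebraMap (𝓞 L) (P.adicCompletionIntegers L))) := by
  intro z
  obtain ⟨x, rfl⟩ := residue_surjective z
  obtain ⟨y, hy⟩ := (HeightOneSpectrum.denseRange_algebraMap L P).exists_mem_open
    (s := {y | Valued.v (y - (x : P.adicCompletion L)) < 1})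
    (by
      have h := Valued.isOpen_ball (P.adicCompletion L) (Γ₀ := ℤᵐ⁰) 1
      simp_rw [Valuation.restrict_lt_one_iff] at h
      exact h.preimage (f := fun y => y - (x : P.adicCompletion L)) (continuous_sub_right _))
    ⟨x, by simp⟩
  have hy1 : P.valuation L y ≤ 1 := by
    rw [← HeightOneSpectrum.valuedAdicCompletion_eq_valuation']
    have h := Valuation.map_add Valued.v (algebraMap L (P.adicCompletion L) y - x)
      (x : P.adicCompletion L)
    rw [sub_add_cancel] at h
    exact h.trans (max_le hy.le x.2)
  obtain ⟨r, hr⟩ := P.exists_valuation_sub_lt_of_integer hy1 1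
  refine ⟨r, ?_⟩
  rw [RingHom.comp_apply, ← sub_eq_zero, ← map_sub, residue_eq_zero_iff,
    mem_maximalIdeal_iff_valued_lt_one]
  have hr' : Valued.v (algebraMap L (P.adicCompletion L) (algebraMap (𝓞 L) L r - y)) < 1 :=
    (HeightOneSpectrum.valuedAdicCompletion_eq_valuation' P _).trans_lt hr
  have h := Valuation.map_add Valued.v
    (algebraMap L (P.adicCompletion L) (algebraMap (𝓞 L) L r - y))
    (algebraMap L (P.adicCompletion L) y - x)
  rw [map_sub, sub_add_sub_cancel, ← map_sub] at h
  exact h.trans_lt (max_lt hr' hy)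

instance finite_residueField : Finite (ResidueField (P.adicCompletionIntegers L)) := by
  have := Ideal.finiteQuotientOfFreeOfNeBot P.asIdeal P.ne_bot
  refine Finite.of_surjective (Ideal.Quotient.lift P.asIdeal
    ((residue (P.adicCompletionIntegers L)).comp
      (algebraMap (𝓞 L) (P.adicCompletionIntegers L))) fun r hr => ?_)
    (Ideal.Quotient.lift_surjective_of_surjective _ _ residue_algebraMap_surjective)
  rw [RingHom.comp_apply, residue_eq_zero_iff, algebraMap_mem_maximalIdeal_iff]
  exact hr

instance compactSpace_adicCompletionIntegers : CompactSpace (P.adicCompletionIntegers L) := by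
  refine Valued.integer.compactSpace_iff_completeSpace_and_isDiscreteValuationRing_and_finite_residueField.2
    ⟨?_, inferInstanceAs (IsDiscreteValuationRing (P.adicCompletionIntegers L)),
      inferInstanceAs (Finite (ResidueField (P.adicCompletionIntegers L)))⟩
  exact (Valued.isClosed_valuationSubring (P.adicCompletion L)).isComplete.completeSpace_coe

theorem maximalIdeal_eq_span {a : 𝓞 L} (ha : a ∈ P.asIdeal) (ha' : a ∉ P.asIdeal ^ 2) :
    maximalIdeal (P.adicCompletionIntegers L) = Ideal.span {algebraMap (𝓞 L) _ a} := by
  refine le_antisymm (fun x hx => ?_) ?_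
  · rw [Ideal.mem_span_singleton]
    refine (HeightOneSpectrum.adicCompletionIntegers.integers L P).dvd_of_le ?_
    rw [mem_maximalIdeal_iff_valued_lt_one] at hx
    -- The value group is discrete: a valuation below 1 is at most `exp (-1)`, and one not at most
    -- `exp (-2)` is at least `exp (-1)`.
    refine le_trans (b := exp (-1 : ℤ)) ?_ ?_
    · change Valued.v (x : P.adicCompletion L) ≤ _
      by_cases h0 : Valued.v (x : P.adicCompletion L) = 0
      · rw [h0]; exact zero_le
      · rw [← exp_log h0] at hx ⊢
        rw [← exp_zero, exp_lt_exp] at hx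
        rw [exp_le_exp]
        omega
    · refine le_trans ?_ (valued_algebraMap a).ge
      have h2 := (P.intValuation_le_pow_iff_mem a 2).not.2 ha'
      by_contra hcon
      apply h2
      have h0 : P.intValuation a ≠ 0 := fun h => h2 (h.trans_le zero_le)
      rw [not_le, ← exp_log h0, exp_lt_exp] at hcon
      rw [← exp_log h0, exp_le_exp]
      push_cast
      omega
  · rw [Ideal.span_singleton_le_iff_mem, algebraMap_mem_maximalIdeal_iff]
    exact ha

theorem eq_zero_of_forall_pow_dvd {R : Type*} [CommRing R] [IsLocalRing R] [IsNoetherianRing R]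
    {π : R} (hmax : maximalIdeal R = Ideal.span {π}) (x : R) (hx : ∀ n, π ^ n ∣ x) : x = 0 := by
  have h := Ideal.iInf_pow_eq_bot_of_isLocalRing (maximalIdeal R) (Ideal.IsPrime.ne_top')
  rw [← Ideal.mem_bot, ← h, Ideal.mem_iInf]
  intro n
  rw [hmax, Ideal.span_singleton_pow, Ideal.mem_span_singleton]
  exact hx n

end Completion

/-! ### What ramification index 1 gives. -/

section Unramified

variable {K L : Type} [Field K] [Field L] [NumberField L] [Algebra K L]
  {p : HeightOneSpectrum (𝓞 K)} {P : HeightOneSpectrum (𝓞 L)} (h : P.asIdeal.LiesOver p.asIdeal)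
  (he : P.asIdeal.ramificationIdx (𝓞 K) = 1)

include h he

/-- Since `e = 1`, the ideal generated by `p` in `𝓞 L` is not contained in the square of `P`. The
resulting uniformizer comes from `K`, so it is fixed by the Galois group. -/
theorem exists_mem_notMem_sq : ∃ a : 𝓞 K, algebraMap (𝓞 K) (𝓞 L) a ∈ P.asIdeal ∧
    algebraMap (𝓞 K) (𝓞 L) a ∉ P.asIdeal ^ 2 := by
  have hle : p.asIdeal.map (algebraMap (𝓞 K) (𝓞 L)) ≤ P.asIdeal :=
    Ideal.map_le_of_le_comap h.over.le
  have h2 : ¬ p.asIdeal.map (algebraMap (𝓞 K) (𝓞 L)) ≤ P.asIdeal ^ 2 := by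
    rw [← Ideal.ramificationIdx'_ne_one_iff hle,
      Ideal.ramificationIdx'_eq_ramificationIdx _ _ p.ne_bot, he]
    simp
  rw [Ideal.map_le_iff_le_comap, SetLike.not_le_iff_exists] at h2
  obtain ⟨a, ha, ha'⟩ := h2
  exact ⟨a, hle (Ideal.mem_map_of_mem _ ha), ha'⟩

/-- The inertia group has order `e = 1`. -/
theorem exists_smul_sub_notMem [NumberField K] [IsGalois K L] (σ : L ≃ₐ[K] L) (hσ : σ ≠ 1) :
    ∃ x : 𝓞 L, σ • x - x ∉ P.asIdeal := by
  by_contra! hcon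
  have := Ideal.finiteQuotientOfFreeOfNeBot p.asIdeal p.ne_bot
  have hc := Ideal.card_inertia_eq_ramificationIdxIn (G := L ≃ₐ[K] L) p.asIdeal P.asIdeal
  rw [Ideal.ramificationIdxIn_eq_ramificationIdx p.asIdeal P.asIdeal (L ≃ₐ[K] L), he,
    Subgroup.card_eq_one] at hc
  have hm : σ ∈ P.asIdeal.inertia (L ≃ₐ[K] L) := hcon
  rw [hc] at hm
  exact hσ (Subgroup.mem_bot.1 hm)

end Unramified

/-! ### The decomposition group acting on local units, and the map from units to `R`. -/

section DecompositionAction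

variable {K L : Type} [Field K] [Field L] [NumberField L] [Algebra K L]
  {P : HeightOneSpectrum (𝓞 L)}

/-- The decomposition group of `P` acts on the valuation ring of `L_P`. -/
noncomputable instance : MulSemiringAction (MulAction.stabilizer (L ≃ₐ[K] L) (Place.finite P))
    (P.adicCompletionIntegers L) where
  smul σ x := finiteMapIntegers P P (σ.1 : L ≃+* L) (valuation_of_smul_eq σ.1 P P σ.2) x
  one_smul x := Subtype.ext (galMap_one (K := K) (Place.finite P) (one_smul _ _)
    (x : P.adicCompletion L))
  mul_smul σ τ x := Subtype.ext (galMap_galMap τ.1 σ.1 _ rfl (Place.finite P) _ _ τ.2 σ.2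
    (σ * τ).2 (x : P.adicCompletion L)).symm
  smul_zero _ := map_zero _
  smul_add _ := map_add _
  smul_one _ := map_one _
  smul_mul _ := map_mul _

variable (σ : MulAction.stabilizer (L ≃ₐ[K] L) (Place.finite P))

theorem smul_algebraMap_integers (r : 𝓞 L) :
    σ • algebraMap (𝓞 L) (P.adicCompletionIntegers L) r =
      algebraMap (𝓞 L) (P.adicCompletionIntegers L) (σ.1 • r) :=
  Subtype.ext (finiteMap_algebraMap P P (σ.1 : L ≃+* L) (valuation_of_smul_eq σ.1 P P σ.2) r)

instance : ContinuousConstSMul (MulAction.stabilizer (L ≃ₐ[K] L) (Place.finite P))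
    (P.adicCompletionIntegers L) where
  continuous_const_smul σ := Continuous.subtype_mk ((continuous_finiteMap P P (σ.1 : L ≃+* L)
    (valuation_of_smul_eq σ.1 P P σ.2)).comp continuous_subtype_val) _

variable (K P) in
/-- The action of the decomposition group on the local units, written additively. -/
noncomputable def unitsAction : MulAction.stabilizer (L ≃ₐ[K] L) (Place.finite P) →*
    AddMonoid.End (Additive (P.adicCompletionIntegers L)ˣ) where
  toFun σ := MonoidHom.toAdditive (Units.map (MulDistribMulAction.toMonoidHom
    (P.adicCompletionIntegers L) σ))
  map_one' := AddMonoidHom.ext fun u => congrArg Additive.ofMul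
    (Units.ext (one_smul _ (u.toMul : P.adicCompletionIntegers L)))
  map_mul' σ τ := AddMonoidHom.ext fun u => congrArg Additive.ofMul
    (Units.ext (mul_smul σ τ (u.toMul : P.adicCompletionIntegers L)))

theorem coe_unitsAction (u : Additive (P.adicCompletionIntegers L)ˣ) :
    (((unitsAction K P σ u).toMul : (P.adicCompletionIntegers L)ˣ) : P.adicCompletionIntegers L) =
      σ • (u.toMul : P.adicCompletionIntegers L) := rfl

variable (ℓ : ℕ) [Fact ℓ.Prime]

variable (P) in
/-- The map from the local units to `R_{L_P}`. -/
noncomputable def unitsToLocalR :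
    Additive (P.adicCompletionIntegers L)ˣ →+ localR ℓ (Place.finite P) :=
  (LAdic.of ℓ).comp (MonoidHom.toAdditive (unitsInclusion P))

theorem unitsToLocalR_unitsAction (u : Additive (P.adicCompletionIntegers L)ˣ) :
    unitsToLocalR P ℓ (unitsAction K P σ u) =
      decompositionRep ℓ (Place.finite P) σ (unitsToLocalR P ℓ u) :=
  (LAdic.map_of ℓ (Units.map (galMap σ.1 (Place.finite P) (Place.finite P) σ.2 :
    (Place.finite P).Completion →* (Place.finite P).Completion)) (unitsInclusion P u.toMul)).symm

/-- The unit group is compact, so every element of its `ℓ`-adification comes from an actual unit. -/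
theorem mem_localU_iff (b : localR ℓ (Place.finite P)) :
    b ∈ localU ℓ (Place.finite P) ↔ ∃ u, unitsToLocalR P ℓ u = b := by
  constructor
  · rintro ⟨y, rfl⟩
    obtain ⟨u, rfl⟩ := LAdic.of_surjective ℓ y
    exact ⟨u, (LAdic.map_of ℓ (unitsInclusion P) u.toMul).symm⟩
  · rintro ⟨u, rfl⟩
    exact ⟨LAdic.of ℓ u, LAdic.map_of ℓ (unitsInclusion P) u.toMul⟩

/-- An `ℓ^n`-th root in the completion of a unit has valuation 1, so divisibility is the same in the
multiplicative group as in the units. -/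
theorem unitsToLocalR_eq_zero_iff (u : Additive (P.adicCompletionIntegers L)ˣ) :
    unitsToLocalR P ℓ u = 0 ↔ ∀ n, ∃ w, w ^ ℓ ^ n = u.toMul := by
  refine (LAdic.of_eq_zero_iff ℓ (unitsInclusion P u.toMul)).trans (forall_congr' fun n => ?_)
  constructor
  · rintro ⟨(b : (P.adicCompletion L)ˣ), hb⟩
    have hb' : (b : P.adicCompletion L) ^ ℓ ^ n = ((u.toMul : P.adicCompletionIntegers L) :
      P.adicCompletion L) := congrArg Units.val hb
    have hv : Valued.v (b : P.adicCompletion L) = 1 := by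
      have h1 := HeightOneSpectrum.adicCompletionIntegers.isUnit_iff_valued_eq_one.1 u.toMul.isUnit
      rw [← hb', map_pow] at h1
      exact (pow_eq_one_iff_left (pow_ne_zero _ (Fact.out : ℓ.Prime).ne_zero)).1 h1
    obtain ⟨w, hw⟩ := (HeightOneSpectrum.adicCompletionIntegers.isUnit_iff_valued_eq_one
      (a := ⟨(b : P.adicCompletion L), hv.le⟩)).2 hv
    refine ⟨w, Units.ext (Subtype.ext ?_)⟩
    rw [← hb', Units.val_pow_eq_pow_val, hw]
    rfl
  · rintro ⟨w, hw⟩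
    exact ⟨unitsInclusion P w, by rw [← map_pow, hw]⟩

theorem exists_root_mem_ker {L : Type} [Field L] [NumberField L] {P : HeightOneSpectrum (𝓞 L)}
    (ℓ : ℕ) [Fact ℓ.Prime] (d : Additive (P.adicCompletionIntegers L)ˣ)
    (hd : unitsToLocalR P ℓ d = 0) : ∃ d', unitsToLocalR P ℓ d' = 0 ∧ ℓ • d' = d := by
  rw [unitsToLocalR_eq_zero_iff] at hd
  obtain ⟨w, hw, hz⟩ := exists_root_of_infinitely_divisible ℓ hd
  exact ⟨Additive.ofMul w, (unitsToLocalR_eq_zero_iff ℓ _).2 hz, hw⟩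

end DecompositionAction

/-! ### Vanishing of `H^0` and `H^1` of the local units at unramified primes. -/

section Unramified

open IsLocalRing

variable {K L : Type} [Field K] [NumberField K] [Field L] [NumberField L] [Algebra K L]
  [IsGalois K L] {p : HeightOneSpectrum (𝓞 K)} {P : HeightOneSpectrum (𝓞 L)}
  (h : P.asIdeal.LiesOver p.asIdeal) (he : P.asIdeal.ramificationIdx (𝓞 K) = 1)

include h he

theorem exists_fixed_uniformizer : ∃ π : P.adicCompletionIntegers L,
    maximalIdeal (P.adicCompletionIntegers L) = Ideal.span {π} ∧
    (∀ g : MulAction.stabilizer (L ≃ₐ[K] L) (Place.finite P), g • π = π) ∧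
    ∀ g : MulAction.stabilizer (L ≃ₐ[K] L) (Place.finite P), g ≠ 1 → ∃ x, ¬ π ∣ g • x - x := by
  obtain ⟨a, ha, ha'⟩ := exists_mem_notMem_sq h he
  have hmax := maximalIdeal_eq_span ha ha'
  refine ⟨_, hmax, fun g => ?_, fun g hg => ?_⟩
  · rw [smul_algebraMap_integers, smul_algebraMap]
  · obtain ⟨x, hx⟩ := exists_smul_sub_notMem h he g.1 (fun h1 => hg (Subtype.ext h1))
    refine ⟨algebraMap _ _ x, ?_⟩
    rwa [smul_algebraMap_integers, ← map_sub, ← Ideal.mem_span_singleton, ← hmax,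
      algebraMap_mem_maximalIdeal_iff]

variable (ℓ : ℕ) [Fact ℓ.Prime]

theorem eq_zero_of_mem_ker (d : Additive (P.adicCompletionIntegers L)ˣ)
    (hd : unitsToLocalR P ℓ d = 0) (h0 : ℓ • d = 0) : d = 0 := by
  obtain ⟨π, hmax, -, -⟩ := exists_fixed_uniformizer h he
  exact eq_one_of_pow_prime_eq_one hmax (Fact.out : ℓ.Prime) (eq_zero_of_forall_pow_dvd hmax)
    ((unitsToLocalR_eq_zero_iff ℓ d).1 hd) h0

/-- The local units at an unramified prime have trivial `H^0`. -/
theorem exists_norm_eq_of_unramified (x : localR ℓ (Place.finite P))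
    (hx : x ∈ localU ℓ (Place.finite P))
    (hinv : ∀ g, decompositionRep (K := K) ℓ (Place.finite P) g x = x) :
    ∃ y ∈ localU ℓ (Place.finite P), ∑ᶠ g, decompositionRep (K := K) ℓ (Place.finite P) g y = x := by
  obtain ⟨π, hmax, hπ, hfaith⟩ := exists_fixed_uniformizer h he
  have := Fintype.ofFinite (MulAction.stabilizer (L ≃ₐ[K] L) (Place.finite P))
  refine exists_norm_eq_of_ker (unitsAction K P) _ (unitsToLocalR P ℓ)
    (fun g u => unitsToLocalR_unitsAction g ℓ u) _ (mem_localU_iff ℓ) (exists_root_mem_ker ℓ)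
    (eq_zero_of_mem_ker h he ℓ) (fun a ha => ?_) x hx hinv
  have hπ0 : π ≠ 0 := by
    rintro rfl
    rw [Ideal.span_singleton_zero] at hmax
    exact IsDiscreteValuationRing.not_a_field _ hmax
  obtain ⟨y, hy⟩ := exists_prod_smul_eq_unit hmax hfaith hπ0 hπ (eq_zero_of_forall_pow_dvd hmax)
    a.toMul fun g => by rw [← coe_unitsAction, ha]
  refine ⟨Additive.ofMul y, ?_⟩
  rw [finsum_eq_sum_of_fintype]
  refine congrArg Additive.ofMul (Units.ext ?_ : (∑ g, unitsAction K P g (.ofMul y)).toMul = a.toMul)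
  rw [← hy, toMul_sum, Units.coe_prod]
  rfl

/-- The local units at an unramified prime have trivial `H^1`. -/
theorem exists_coboundary_of_unramified
    (c : MulAction.stabilizer (L ≃ₐ[K] L) (Place.finite P) → localR ℓ (Place.finite P))
    (hcU : ∀ g, c g ∈ localU ℓ (Place.finite P))
    (hc : ∀ g g', c (g * g') = decompositionRep ℓ (Place.finite P) g (c g') + c g) :
    ∃ y ∈ localU ℓ (Place.finite P), ∀ g, decompositionRep ℓ (Place.finite P) g y - y = c g := by
  obtain ⟨π, hmax, -, hfaith⟩ := exists_fixed_uniformizer h he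
  have := Fintype.ofFinite (MulAction.stabilizer (L ≃ₐ[K] L) (Place.finite P))
  refine exists_coboundary_of_ker (unitsAction K P) _ (unitsToLocalR P ℓ)
    (fun g u => unitsToLocalR_unitsAction g ℓ u) _ (mem_localU_iff ℓ) (exists_root_mem_ker ℓ)
    (eq_zero_of_mem_ker h he ℓ) (fun f hf => ?_) c hcU hc
  obtain ⟨w, hw⟩ := exists_unit_coboundary hmax hfaith (fun g => (f g).toMul) fun g g' => by
    rw [hf, toMul_add, Units.val_mul, coe_unitsAction]
  refine ⟨Additive.ofMul w, fun g => ?_⟩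
  rw [sub_eq_iff_eq_add]
  exact congrArg Additive.ofMul (Units.ext (hw g).symm)

end Unramified

/-! ### Places outside `S`, and the `S`-ideles as a case of the general setting. -/

section UnramifiedPlaces

variable {K L : Type} [Field K] [NumberField K] [Field L] [NumberField L] [Algebra K L]
  {S : Finset (Place K)} (hinf : ∀ w : InfinitePlace K, Place.infinite w ∈ S)
  (hram : ∀ p : HeightOneSpectrum (𝓞 K), IsRamifiedPrime L p → Place.finite p ∈ S)

include hinf hram in
theorem exists_eq_finite_of_notMem {p : Place K} (hp : p ∉ S) {v : Place L} (hv : v.LiesOver p) :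
    ∃ (q : HeightOneSpectrum (𝓞 K)) (Q : HeightOneSpectrum (𝓞 L)), v = .finite Q ∧
      Q.asIdeal.LiesOver q.asIdeal ∧ Q.asIdeal.ramificationIdx (𝓞 K) = 1 := by
  match v, p, hv, hp with
  | .finite Q, .finite q, hv, hp =>
    exact ⟨q, Q, rfl, hv, by_contra fun he => hp (hram q ⟨Q, hv, he⟩)⟩
  | .infinite _, .infinite w, _, hp => exact absurd (hinf w) hp

variable [IsGalois K L] (ℓ : ℕ) [Fact ℓ.Prime]

include hinf hram in
/-- Outside `S`, the local units have trivial `H^0`. -/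
theorem exists_norm_eq_of_notMem {p : Place K} (hp : p ∉ S) {v : Place L} (hv : v.LiesOver p)
    (x : localR ℓ v) (hx : x ∈ localU ℓ v) (hinv : ∀ g, decompositionRep (K := K) ℓ v g x = x) :
    ∃ y ∈ localU ℓ v, ∑ᶠ g, decompositionRep (K := K) ℓ v g y = x := by
  obtain ⟨q, Q, rfl, h, he⟩ := exists_eq_finite_of_notMem hinf hram hp hv
  exact exists_norm_eq_of_unramified h he ℓ x hx hinv

include hinf hram in
/-- Outside `S`, the local units have trivial `H^1`. -/
theorem exists_coboundary_of_notMem {p : Place K} (hp : p ∉ S) {v : Place L} (hv : v.LiesOver p)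
    (c : MulAction.stabilizer (L ≃ₐ[K] L) v → localR ℓ v) (hcU : ∀ g, c g ∈ localU ℓ v)
    (hc : ∀ g g', c (g * g') = decompositionRep ℓ v g (c g') + c g) :
    ∃ y ∈ localU ℓ v, ∀ g, decompositionRep ℓ v g y - y = c g := by
  obtain ⟨q, Q, rfl, h, he⟩ := exists_eq_finite_of_notMem hinf hram hp hv
  exact exists_coboundary_of_unramified h he ℓ c hcU hc

/-- Only finitely many places lie above the finite set `S`, so the finiteness condition is automatic
and the `S`-ideles take the form required for `J`. -/
theorem PlaceSystem.mem_sIdeles_iff {K L : Type} [Field K] [NumberField K] [Field L]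
    [NumberField L] [Algebra K L] (ℓ : ℕ) [Fact ℓ.Prime] [FiniteDimensional K L] (E : PlaceSystem K L)
    (S : Finset (Place K)) (x : ∀ v : Place L, localR ℓ v) :
    x ∈ (sIdeles ℓ L (S : Set (Place K))).toSubmodule ↔ {v | x v ∉ localU ℓ v}.Finite ∧
      ∀ v, E.below v ∉ Set.range ((↑) : {p // p ∈ S} → Place K) → x v ∈ localU ℓ v := by
  have key : ∀ v : Place L, E.below v ∉ Set.range ((↑) : {p // p ∈ S} → Place K) ↔
      ∀ p ∈ (S : Set (Place K)), ¬ v.LiesOver p := fun v => by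
    rw [Subtype.range_coe_subtype]
    constructor
    · intro h p hp hv
      rw [E.below_eq hv] at h
      exact h hp
    · exact fun h hv => h _ hv (E.liesOver_below v)
  simp_rw [key]
  refine ⟨fun h => ⟨(E.finite_liesOver S.finite_toSet).subset fun v hv => ?_, h⟩, fun h => h.2⟩
  by_contra hcon
  refine hv (h v fun p hp hvp => hcon ?_)
  rw [Set.mem_ofPred_eq, E.below_eq hvp]
  exact hp

end UnramifiedPlaces

end EllAdic

theorem proposition3p2p4 (ℓ : ℕ) [Fact ℓ.Prime]
    (K L : Type) [Field K] [NumberField K] [Field L] [NumberField L] [Algebra K L] [IsGalois K L]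
    (S : Finset (Place K)) (hinf : ∀ w : InfinitePlace K, Place.infinite w ∈ S)
    (hram : ∀ p : HeightOneSpectrum (𝓞 K), IsRamifiedPrime L p → Place.finite p ∈ S)
    (P : Place K → Place L) (hP : ∀ p, (P p).LiesOver p)
    (i : ℕ) (hi : i = 0 ∨ i = 1) :
    (∃ e : tateH (sIdeleRep ℓ L (S : Set (Place K))) i ≃ₗ[ℤ_[ℓ]]
        DirectSum {p // p ∈ S} (fun p => tateH (localRep ℓ K (P p)) i),
      ∀ p : {p // p ∈ S}, IsRestriction (sIdeleRep ℓ L (S : Set (Place K))) (localRep ℓ K (P p))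
        (sIdeleProj ℓ (S : Set (Place K)) (P p)) i
        (DirectSum.component ℤ_[ℓ] _ _ p ∘ₗ e.toLinearMap)) ∧
    (∃ e : tateH (ideleRep ℓ K L) i ≃ₗ[ℤ_[ℓ]]
        DirectSum (Place K) (fun p => tateH (localRep ℓ K (P p)) i),
      ∀ p : Place K, IsRestriction (ideleRep ℓ K L) (localRep ℓ K (P p)) (ideleProj ℓ (P p)) i
        (DirectSum.component ℤ_[ℓ] _ _ p ∘ₗ e.toLinearMap)) := by
  let E := PlaceSystem.ofRep P hP
  have hS : ∀ p ∈ S, p ∈ Set.range ((↑) : {p // p ∈ S} → Place K) := fun p hp => ⟨⟨p, hp⟩, rfl⟩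
  -- For the full ideles the family is indexed by the identity, and the condition outside its image
  -- is empty.
  have hJ : ∀ x, x ∈ (ideles ℓ K L).toSubmodule ↔ {v | x v ∉ localU ℓ v}.Finite ∧
      ∀ v, E.below v ∉ Set.range (id : Place K → Place K) → x v ∈ localU ℓ v := fun x =>
    ⟨fun h => ⟨h, fun v hv => absurd ⟨_, rfl⟩ hv⟩, fun h => h.1⟩
  have hac0 := fun p (hp : p ∉ S) => exists_norm_eq_of_notMem hinf hram ℓ hp (E.liesOver_rep p)
  have hac1 := fun p (hp : p ∉ S) => exists_coboundary_of_notMem hinf hram ℓ hp (E.liesOver_rep p)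
  rcases hi with rfl | rfl
  · exact ⟨E.exists_tateH_zero Subtype.val_injective _ (E.mem_sIdeles_iff ℓ S) S hS hac0,
      E.exists_tateH_zero Function.injective_id _ hJ S (fun p _ => ⟨p, rfl⟩) hac0⟩
  · exact ⟨E.exists_tateH_one Subtype.val_injective _ (E.mem_sIdeles_iff ℓ S) S hS hac1,
      E.exists_tateH_one Function.injective_id _ hJ S (fun p _ => ⟨p, rfl⟩) hac1⟩
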